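/- **Setting.** Let $N,M\ge 1$ and $1\le L\le N$. Given are channels $H=[h_1,\dots,h_M]\in\mathbb C^{N\times M}$, noise levels $\sigma_m>0$ and SINR targets $\gamma_m>0$ (and, for imperfect CSI, error radii $\varepsilon_m>0$). For $W=[w_1,\dots,w_M]\in\mathbb C^{N\times M}$ and $h\in\mathbb C^N$ let $$\mathrm{SINR}_m(W,h)=\frac{|w_m^Hh|^2}{\sum_{\ell\ne m}|w_\ell^Hh|^2+\sigma_m^2},\qquad \mathcal U_m=\{h_m+e:\|e\|_2\le\varepsilon_m\}.$$ The joint BF&AS problem is to minimize $\|W\|_F^2$ subject to $\mathrm{SINR}_m(W,h_m)\ge\gamma_m$ for all $m$ and at most $L$ nonzero rows of $W$; in the joint RBF&AS problem the SINR constraint is $\min_{h\in\mathcal U_m}\mathrm{SINR}_m(W,h)\ge\gamma_m$ for all $m$. **Subproblems.** For $B\subseteq[N]$ let $\mathcal P(B)$ be the following convex program. For BF it is the SOCP: minimize $\|W\|_F^2$ subject to $\gamma_m^{-1/2}\,\mathrm{Re}(w_m^Hh_m)\ge\big(\sum_{\ell\ne m}|w_\ell^Hh_m|^2+\sigma_m^2\big)^{1/2}$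 for all $m$ and $W(n,:)=0$ for $n\in B$. For RBF it is the semidefinite relaxation (SDR): minimize $\sum_m\mathrm{Tr}(W_m)$ over positive semidefinite $W_1,\dots,W_M\in\mathbb C^{N\times N}$ subject to $\frac{h^HW_mh}{\sum_{j\ne m}h^HW_jh+\sigma_m^2}\ge\gamma_m$ for all $m$ and $h\in\mathcal U_m$, and $W_m(n,:)=0$ for $n\in B$; a beamforming matrix is read off its solution if $W_m=w_mw_m^H$ for all $m$. A solver returns an arbitrary optimal solution of $\mathcal P(B)$, or reports infeasibility (value $+\infty$). The power of antenna $n$ in a solution is $\|W(n,:)\|_2^2$, respectively $\sum_mW_m(n,n)$. **The B&B procedure.** A node is a pair $(A,B)$ of disjoint sets of activated and shut-down antennas; as soon as $|A|=L$ one sets $B=[N]\setminus A$, and as soon as $|B|=N-L$ one sets $A=[N]\setminus B$; the node is then a leaf. The lower bound $\Phi_{\rm lb}(A,B)$ is the value of $\mathcal P(B)$. The upper bound $\Phi_{\rm ub}(A,B)$ is $\|W\|_F^2$ for the beamforming matrix $W$ obtained from $\mathcal P(\tilde B)$, where $\tilde B\supseteq B$ has $N-L$ elements and consists of $B$ and of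 undecided antennas of smallest power in the solution of $\mathcal P(B)$ ($+\infty$ if there is no such $W$). The procedure starts with the root $(\emptyset,\emptyset)$ as the only unbranched node, its lower bound as $l_G$, its upper bound as $u_G$ and its upper bound solution as incumbent. While the set $\mathcal F$ of unbranched nodes is nonempty and $|u_G-l_G|/l_G>\epsilon$ ($\epsilon\ge0$ a given tolerance; the gap is $0$ if $u_G=l_G=+\infty$), it removes from $\mathcal F$ a non-leaf node of lowest lower bound, selects an undecided antenna $n$ of largest power in its lower bound solution, adds the children that shut down, respectively activate, $n$; replaces $u_G$ and the incumbent by the better upper bound of the two children if that is $\le u_G$; sets $l_G$ to the minimum of $\Phi_{\rm lb}$ on $\mathcal F$; and discards from $\mathcal F$ the nodes with $\Phi_{\rm lb}>u_G$. It returns the incumbent. Ties are broken arbitrarily. Solutions of programs are stored: a program that was solved before is not solved again. **The alternative B&B** is the same procedure for the formulation with Boolean variables $z\in\{0,1\}^N$, $\sum_nz(n)\le L$, $\|W(n,:)\|_2\le Cz(n)$, where $C>0$ is a constant. The lower bound at $(A,B)$ is the value of the SOCP/SDR in $(W,z)$ with $z\in[0,1]^N$, $\sum_nz(n)\le L$,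 $z=0$ on $B$, $z=1$ on $A$ and $\|W(n,:)\|_2\le Cz(n)$ (in the SDR: $\sum_mW_m(n,n)\le C^2z(n)$); the upper bound is the same program at the leaf $([N]\setminus\tilde B,\tilde B)$; the branching antenna and the undecided antennas in $\tilde B$ are chosen in any way. **Theorem.** (a) *(Perfect CSI.)* For every SOCP solver and every $\epsilon\ge0$, the proposed B&B procedure terminates and solves the joint BF&AS problem to global optimality: it returns a feasible $W$ with $\|W\|_F^2\le(1+\epsilon)\|W'\|_F^2$ for every feasible $W'$ (in particular an exact global minimizer if $\epsilon=0$), or it returns nothing, and then the problem is infeasible. (b) *(Imperfect CSI.)* Suppose that for every $\mathcal S\subseteq[N]$ with $|\mathcal S|\ge L$ the matrix $\tilde H=H(\mathcal S,:)$ with columns $\tilde h_m$ satisfies, for all $m$, $$\frac{\|\Pi_m\tilde h_m\|_2^2}{\varepsilon_m^2}>1+M+\Big(M-\frac1M\Big)\gamma_m,\qquad \Pi_m=I-\tilde H_{-m}(\tilde H_{-m}^H\tilde H_{-m})^{-1}\tilde H_{-m}^H,$$ where $\tilde H_{-m}$ is $\tilde H$ without its $m$-th column and $\tilde H_{-m}^H\tilde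 H_{-m}$ is invertible. Then, for every SDR solver, the conclusion of (a) holds for the proposed B&B procedure and the joint RBF&AS problem. (c) In both cases (for imperfect CSI also without the condition in (b)), every run of the proposed B&B procedure is finite and the total number of SOCPs/SDRs solved in it is at most $$\binom NL+\sum_{i=2}^{N-L+1}\binom{N-i}{L-1}.$$ Every run of the alternative B&B is finite and the number of SOCPs/SDRs solved in it is at most $2\binom NL-1$. All the programs above have an optimal solution whenever they are feasible, so solvers exist. -/

import Mathlib

open scoped NNReal ENNReal ComplexOrder Matrix

noncomputable section

namespace BFAS

/-! ### The beamforming and antenna selection problems -/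

/-- Beamforming matrices: one row per antenna, one column per user. -/
abbrev Beam (N M : ℕ) : Type := Matrix (Fin N) (Fin M) ℂ

/-- A problem instance: channel matrix, noise levels, SINR targets, channel error radii. -/
structure Instance (N M : ℕ) where
  H : Matrix (Fin N) (Fin M) ℂ
  σ : Fin M → ℝ
  γ : Fin M → ℝ
  ε : Fin M → ℝ

variable {N M : ℕ}

/-- Squared Frobenius norm. -/
def power (W : Beam N M) : ℝ := ∑ n, ∑ m, ‖W n m‖ ^ 2

/-- Squared Euclidean norm of a row. -/
def rowPower (W : Beam N M) (n : Fin N) : ℝ := ∑ m, ‖W n m‖ ^ 2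

/-- Number of nonzero rows. -/
def rowZero (W : Beam N M) : ℕ := {n : Fin N | W.row n ≠ 0}.ncard

/-- `w_jᴴ h`. -/
def gain (W : Beam N M) (j : Fin M) (h : Fin N → ℂ) : ℂ := star (W.col j) ⬝ᵥ h

/-- Signal to interference and noise ratio of user `m` when its channel is `h`. -/
def sinr (P : Instance N M) (W : Beam N M) (m : Fin M) (h : Fin N → ℂ) : ℝ :=
  ‖gain W m h‖ ^ 2 / (∑ l ∈ Finset.univ.erase m, ‖gain W l h‖ ^ 2 + P.σ m ^ 2)

/-- The ball of possible channels of user `m`. -/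
def channelBall (P : Instance N M) (m : Fin M) : Set (Fin N → ℂ) :=
  {h | ‖(WithLp.toLp 2 (h - P.H.col m) : EuclideanSpace ℂ (Fin N))‖ ≤ P.ε m}

/-- Feasible set of the joint beamforming and antenna selection problem (perfect CSI). -/
def bfas (P : Instance N M) (L : ℕ) : Set (Beam N M) :=
  {W | (∀ m, P.γ m ≤ sinr P W m (P.H.col m)) ∧ rowZero W ≤ L}

/-- Feasible set of the joint robust beamforming and antenna selection problem
(imperfect CSI). -/
def rbfas (P : Instance N M) (L : ℕ) : Set (Beam N M) :=
  {W | (∀ m, ∀ h ∈ channelBall P m, P.γ m ≤ sinr P W m h) ∧ rowZero W ≤ L}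

/-! ### Convex programs and their solvers -/

structure Program (X : Type) where
  feasible : Set X
  objective : X → ℝ

/-- `solve` returns an (arbitrary) optimal solution of each feasible program of the family
`p`, and `none` for the infeasible ones. -/
def IsSolver {κ X : Type} (p : κ → Program X) (solve : κ → Option X) : Prop :=
  ∀ k, (∀ x, solve k = some x →
      x ∈ (p k).feasible ∧ ∀ y ∈ (p k).feasible, (p k).objective x ≤ (p k).objective y) ∧
    (solve k = none → (p k).feasible = ∅)

/-- Second-order cone form of the SINR constraints. -/
def socConstraint (P : Instance N M) (W : Beam N M) : Prop :=
  ∀ m, √(∑ l ∈ Finset.univ.erase m, ‖gain W l (P.H.col m)‖ ^ 2 + P.σ m ^ 2) ≤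
    1 / √(P.γ m) * (gain W m (P.H.col m)).re

/-- SOCP of beamforming with the antennas in `B` shut down. -/
def socp (P : Instance N M) (B : Finset (Fin N)) : Program (Beam N M) where
  feasible := {W | socConstraint P W ∧ ∀ n ∈ B, W.row n = 0}
  objective := power

/-- Variables of the semidefinite relaxation: one `N × N` matrix per user. -/
abbrev Lifted (N M : ℕ) : Type := Fin M → Matrix (Fin N) (Fin N) ℂ

/-- `hᴴ S h` -/
def quad (S : Matrix (Fin N) (Fin N) ℂ) (h : Fin N → ℂ) : ℝ := (star h ⬝ᵥ (S *ᵥ h)).re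

/-- Lifted worst-case SINR constraints, the rank-one constraint being dropped. -/
def sdrConstraint (P : Instance N M) (S : Lifted N M) : Prop :=
  (∀ m, (S m).PosSemidef) ∧
  ∀ m, ∀ h ∈ channelBall P m,
    P.γ m ≤ quad (S m) h / (∑ l ∈ Finset.univ.erase m, quad (S l) h + P.σ m ^ 2)

/-- Total power `∑ Tr W_m`. -/
def liftedPower (S : Lifted N M) : ℝ := ∑ m, (S m).trace.re

/-- Power that a lifted solution assigns to antenna `n`. -/
def liftedRowPower (S : Lifted N M) (n : Fin N) : ℝ := ∑ m, (S m n n).re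

/-- SDR of robust beamforming with the antennas in `B` shut down. -/
def sdr (P : Instance N M) (B : Finset (Fin N)) : Program (Lifted N M) where
  feasible := {S | sdrConstraint P S ∧ ∀ m, ∀ n ∈ B, (S m).row n = 0}
  objective := liftedPower

open Classical in
/-- Beamformers `w_m` with `W_m = w_m w_mᴴ` if there are any. -/
def extract (S : Lifted N M) : Option (Beam N M) :=
  if h : ∃ W : Beam N M, ∀ m, S m = Matrix.vecMulVec (W.col m) (star (W.col m)) then
    some h.choose
  else none

/-! ### The sufficient condition for tightness of the SDR -/

/-- `I - G (Gᴴ G)⁻¹ Gᴴ` -/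
def complProj {ι κ : Type} [Fintype ι] [DecidableEq ι] [Fintype κ] [DecidableEq κ]
    (G : Matrix ι κ ℂ) : Matrix ι ι ℂ := 1 - G * (Gᴴ * G)⁻¹ * Gᴴ

/-- The condition, for every submatrix `H(S,:)` of at least `L` rows and every user `m`.
`G` is `H(S,:)` without its `m`-th column; `Gᴴ G` has to be invertible for the projector to
make sense. -/
def sdrCondition (P : Instance N M) (L : ℕ) : Prop :=
  ∀ S : Finset (Fin N), L ≤ S.card → ∀ m : Fin M,
    let G : Matrix S {j : Fin M // j ≠ m} ℂ := P.H.submatrix Subtype.val Subtype.val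
    let h : S → ℂ := fun n => P.H n m
    IsUnit (Gᴴ * G).det ∧
    1 + (M : ℝ) + ((M : ℝ) - 1 / (M : ℝ)) * P.γ m <
      ‖(WithLp.toLp 2 (complProj G *ᵥ h) : EuclideanSpace ℂ S)‖ ^ 2 / P.ε m ^ 2

/-! ### Branch and bound -/

/-- A node of the search tree: the activated antennas `A`, the antennas `B` shut down. -/
structure Node (N : ℕ) where
  A : Finset (Fin N)
  B : Finset (Fin N)
deriving DecidableEq

namespace Node

def IsLeaf (L : ℕ) (ν : Node N) : Prop := ν.A.card = L ∧ ν.B.card = N - L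

/-- Decides the remaining antennas once `L` are activated or `N - L` are shut down. -/
def complete (L : ℕ) (ν : Node N) : Node N :=
  if ν.A.card = L then ⟨ν.A, ν.Aᶜ⟩
  else if ν.B.card = N - L then ⟨ν.Bᶜ, ν.B⟩
  else ν

/-- Nothing is decided (unless `L = N`, when there is nothing to decide). -/
def root (N L : ℕ) : Node N := complete L ⟨∅, ∅⟩

def left (L : ℕ) (ν : Node N) (n : Fin N) : Node N := complete L ⟨ν.A, insert n ν.B⟩

def right (L : ℕ) (ν : Node N) (n : Fin N) : Node N := complete L ⟨insert n ν.A, ν.B⟩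

def undecided (ν : Node N) : Finset (Fin N) := (ν.A ∪ ν.B)ᶜ

end Node

/-- What distinguishes the branch-and-bound methods. `κ` indexes the convex programs that are
handed to the solver, `X` is the type of their solutions. -/
structure Method (N M : ℕ) (κ X : Type) where
  /-- The solver. -/
  solve : κ → Option X
  /-- Objective value of a solution. -/
  value : X → ℝ
  /-- The beamforming matrix read off a solution, if there is one. -/
  beam : X → Option (Beam N M)
  /-- The program for the lower bound at a node. -/
  lbKey : Node N → κ
  /-- The program for the upper bound that shuts down exactly the given antennas. -/
  ubKey : Finset (Fin N) → κ
  /-- Admissible branching antennas, given the lower bound solution at the node. -/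
  mayBranch : Node N → X → Fin N → Prop
  /-- Admissible sets to shut down in the upper bound, given the lower bound solution. -/
  mayExclude : Node N → X → Finset (Fin N) → Prop

/-- State of a run. `cache` holds the programs solved so far, whose solutions are stored and
reused; `calls` counts the programs handed to the solver. -/
structure State (N M : ℕ) (κ : Type) where
  frontier : Finset (Node N)
  incumbent : Option (Beam N M)
  upper : ℝ≥0∞
  lower : ℝ≥0∞
  cache : Finset κ
  calls : ℕ

/-- Objective value of an optional beamforming matrix, `+∞` if there is none. -/
def cost : Option (Beam N M) → ℝ≥0∞
  | some W => ENNReal.ofReal (power W)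
  | none => ⊤

/-- Look up one program: it is solved only if it is not in the cache. -/
def query {κ : Type} [DecidableEq κ] (c : Finset κ × ℕ) (k : κ) : Finset κ × ℕ :=
  if k ∈ c.1 then c else (insert k c.1, c.2 + 1)

/-- `|u - l| / l`, with the value `0` for `u = l = +∞`. -/
def relGap (u l : ℝ≥0∞) : ℝ≥0∞ := ((u - l) + (l - u)) / l

namespace Method

variable {κ X : Type} [DecidableEq κ]

/-- Lower bound at a node, `+∞` if the program is infeasible. -/
def lb (E : Method N M κ X) (ν : Node N) : ℝ≥0∞ :=
  match E.solve (E.lbKey ν) with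
  | some x => ENNReal.ofReal (E.value x)
  | none => ⊤

/-- `o` is the set of `N - L` antennas that the upper bound at `ν` shuts down: those already
shut down and some undecided ones. No upper bound program is solved (`o = none`) if already
the lower bound program is infeasible. -/
def Excludes (E : Method N M κ X) (L : ℕ) (ν : Node N) : Option (Finset (Fin N)) → Prop
  | some T => ν.B ⊆ T ∧ T ⊆ ν.B ∪ ν.undecided ∧ T.card = N - L ∧
      ∃ x, E.solve (E.lbKey ν) = some x ∧ E.mayExclude ν x T
  | none => E.solve (E.lbKey ν) = none

/-- The beamforming matrix of the upper bound. -/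
def ubBeam (E : Method N M κ X) (o : Option (Finset (Fin N))) : Option (Beam N M) :=
  o.bind fun T => (E.solve (E.ubKey T)).bind E.beam

/-- Computes the lower and then the upper bound at `ν`, as far as cache and calls go. -/
def evaluate (E : Method N M κ X) (c : Finset κ × ℕ) (ν : Node N)
    (o : Option (Finset (Fin N))) : Finset κ × ℕ :=
  match o with
  | some T => query (query c (E.lbKey ν)) (E.ubKey T)
  | none => query c (E.lbKey ν)

/-- Initial states. -/
def Initial (E : Method N M κ X) (L : ℕ) (s : State N M κ) : Prop :=
  ∃ o, E.Excludes L (Node.root N L) o ∧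
    s = { frontier := {Node.root N L}
          incumbent := E.ubBeam o
          upper := cost (E.ubBeam o)
          lower := E.lb (Node.root N L)
          cache := (E.evaluate (∅, 0) (Node.root N L) o).1
          calls := (E.evaluate (∅, 0) (Node.root N L) o).2 }

/-- The stopping criterion with relative tolerance `tol`. -/
def Halted (tol : ℝ≥0) (s : State N M κ) : Prop :=
  s.frontier = ∅ ∨ relGap s.upper s.lower ≤ tol

/-- The state after branching `ν` into `ν₁` and `ν₂`, where `W` is the better one of the
upper bound solutions of the two children and `c` is the new content of cache and counter. -/
def next (E : Method N M κ X) (s : State N M κ) (ν ν₁ ν₂ : Node N) (W : Option (Beam N M))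
    (c : Finset κ × ℕ) : State N M κ :=
  let F : Finset (Node N) := insert ν₁ (insert ν₂ (s.frontier.erase ν))
  let u : ℝ≥0∞ := if cost W ≤ s.upper then cost W else s.upper
  { frontier := F.filter fun ν' => E.lb ν' ≤ u
    incumbent := if cost W ≤ s.upper then W else s.incumbent
    upper := u
    lower := F.inf E.lb
    cache := c.1
    calls := c.2 }

/-- One iteration: a non-leaf node of lowest lower bound is branched. All ties (node,
branching antenna, sets shut down, better child) may be broken in any way. -/
def Step (E : Method N M κ X) (L : ℕ) (tol : ℝ≥0) (s s' : State N M κ) : Prop :=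
  ¬ Halted tol s ∧
  ∃ ν ∈ s.frontier, ¬ ν.IsLeaf L ∧
    (∀ ν' ∈ s.frontier, ¬ ν'.IsLeaf L → E.lb ν ≤ E.lb ν') ∧
  ∃ x, E.solve (E.lbKey ν) = some x ∧
  ∃ n ∈ ν.undecided, E.mayBranch ν x n ∧
  ∃ o₁ o₂, E.Excludes L (ν.left L n) o₁ ∧ E.Excludes L (ν.right L n) o₂ ∧
  ∃ W, (W = E.ubBeam o₁ ∨ W = E.ubBeam o₂) ∧
    cost W ≤ cost (E.ubBeam o₁) ∧ cost W ≤ cost (E.ubBeam o₂) ∧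
  s' = E.next s ν (ν.left L n) (ν.right L n) W
    (E.evaluate (E.evaluate (s.cache, s.calls) (ν.left L n) o₁) (ν.right L n) o₂)

/-- States that occur in some run. -/
def Reachable (E : Method N M κ X) (L : ℕ) (tol : ℝ≥0) (s : State N M κ) : Prop :=
  ∃ s₀, E.Initial L s₀ ∧ Relation.ReflTransGen (E.Step L tol) s₀ s

/-- The method can be started and has no infinite run. -/
def Terminates (E : Method N M κ X) (L : ℕ) (tol : ℝ≥0) : Prop :=
  (∃ s, E.Initial L s) ∧
  ¬ ∃ s : ℕ → State N M κ, E.Initial L (s 0) ∧ ∀ t, E.Step L tol (s t) (s (t + 1))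

/-- Every run is finite, does not stop before the stopping criterion is met, and then returns
a global minimizer of `power` on `feas`, up to the factor `1 + tol` (so an exact one for
`tol = 0`); it returns nothing only if `feas` is empty. -/
def SolvesOptimally (E : Method N M κ X) (L : ℕ) (tol : ℝ≥0) (feas : Set (Beam N M)) : Prop :=
  E.Terminates L tol ∧
  (∀ s, E.Reachable L tol s → ¬ Halted tol s → ∃ s', E.Step L tol s s') ∧
  ∀ s, E.Reachable L tol s → Halted tol s →
    (∀ W, s.incumbent = some W →
      W ∈ feas ∧ ∀ W' ∈ feas, power W ≤ (1 + (tol : ℝ)) * power W') ∧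
    (s.incumbent = none → feas = ∅)

/-- Every run is finite and hands at most `Q` programs to the solver. -/
def SolvesAtMost (E : Method N M κ X) (L : ℕ) (tol : ℝ≥0) (Q : ℕ) : Prop :=
  E.Terminates L tol ∧ ∀ s, E.Reachable L tol s → s.calls ≤ Q

end Method

/-- Branch on an undecided antenna of largest power `p`. -/
def branchLargest {X : Type} (p : X → Fin N → ℝ) (ν : Node N) (x : X) (n : Fin N) : Prop :=
  ∀ i ∈ ν.undecided, p x i ≤ p x n

/-- Shut down undecided antennas of smallest power `p`. -/
def excludeSmallest {X : Type} (p : X → Fin N → ℝ) (ν : Node N) (x : X)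
    (T : Finset (Fin N)) : Prop :=
  ∀ i ∈ T \ ν.B, ∀ j ∈ ν.undecided \ T, p x i ≤ p x j

/-- The proposed method for perfect CSI. -/
def socpBB (solve : Finset (Fin N) → Option (Beam N M)) :
    Method N M (Finset (Fin N)) (Beam N M) where
  solve := solve
  value := power
  beam := some
  lbKey := Node.B
  ubKey := id
  mayBranch := branchLargest rowPower
  mayExclude := excludeSmallest rowPower

/-- The proposed method for imperfect CSI. -/
def sdrBB (solve : Finset (Fin N) → Option (Lifted N M)) :
    Method N M (Finset (Fin N)) (Lifted N M) where
  solve := solve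
  value := liftedPower
  beam := extract
  lbKey := Node.B
  ubKey := id
  mayBranch := branchLargest liftedRowPower
  mayExclude := excludeSmallest liftedRowPower

/-! ### The alternative method with relaxed Boolean variables -/

/-- Constraints on the relaxed Boolean variables at a node. -/
def boolRelaxed (L : ℕ) (ν : Node N) (z : Fin N → ℝ) : Prop :=
  (∀ n, 0 ≤ z n ∧ z n ≤ 1) ∧ ∑ n, z n ≤ L ∧ (∀ n ∈ ν.B, z n = 0) ∧ ∀ n ∈ ν.A, z n = 1

/-- Relaxed node problem, perfect CSI. -/
def bigMSocp (P : Instance N M) (L : ℕ) (C : ℝ) (ν : Node N) :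
    Program (Beam N M × (Fin N → ℝ)) where
  feasible := {Y | socConstraint P Y.1 ∧ boolRelaxed L ν Y.2 ∧
    ∀ n, √(rowPower Y.1 n) ≤ C * Y.2 n}
  objective := fun Y => power Y.1

/-- Relaxed node problem, imperfect CSI. The row constraint `‖W(n,:)‖ ≤ C z(n)`, which for
Boolean `z` says `‖W(n,:)‖² ≤ C² z(n)`, is lifted in the latter form, which is convex. -/
def bigMSdr (P : Instance N M) (L : ℕ) (C : ℝ) (ν : Node N) :
    Program (Lifted N M × (Fin N → ℝ)) where
  feasible := {Y | sdrConstraint P Y.1 ∧ boolRelaxed L ν Y.2 ∧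
    ∀ n, liftedRowPower Y.1 n ≤ C ^ 2 * Y.2 n}
  objective := fun Y => liftedPower Y.1

/-- The alternative method, perfect CSI, with any choice of branching antennas and of
antennas to shut down. The upper bound is the node problem with all Boolean variables fixed. -/
def bigMSocpBB (solve : Node N → Option (Beam N M × (Fin N → ℝ))) :
    Method N M (Node N) (Beam N M × (Fin N → ℝ)) where
  solve := solve
  value := fun Y => power Y.1
  beam := fun Y => some Y.1
  lbKey := id
  ubKey := fun T => ⟨Tᶜ, T⟩
  mayBranch := fun _ _ _ => True
  mayExclude := fun _ _ _ => True

/-- The alternative method, imperfect CSI. -/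
def bigMSdrBB (solve : Node N → Option (Lifted N M × (Fin N → ℝ))) :
    Method N M (Node N) (Lifted N M × (Fin N → ℝ)) where
  solve := solve
  value := fun Y => liftedPower Y.1
  beam := fun Y => extract Y.1
  lbKey := id
  ubKey := fun T => ⟨Tᶜ, T⟩
  mayBranch := fun _ _ _ => True
  mayExclude := fun _ _ _ => True

end BFAS

end

/-!
Leaves are exact: at a leaf the relaxation and the original problem have the same value. For the
SOCP, rotate the phase of each beamformer so that `w_mᴴ h_m` is real. For the SDR, split an
optimal `W_m` as `a aᴴ + D` with `D` positive semidefinite, where `D` annihilates the vector at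
which the robust constraint is critical. Replacing `D` by a little power in all the zero-forcing
directions keeps every constraint and, under the condition on the projections, is strictly cheaper
unless `D = 0`.

Given exactness, branch and bound works for any relaxation that is monotone along the tree: every
leaf is either below an unbranched node or was discarded because it costs more than the incumbent,
so `l_G` never exceeds the optimum. An unbranched leaf has a lower bound that is at least `u_G`,
so a non-leaf of lower bound `l_G` is available for branching as long as the gap is open.

For the number of programs, there are at most `N.choose L` programs at leaves. When the program of
a node depends only on the antennas shut down, every further program comes from an inner node that
is the root or has just shut an antenna down, and these are at most `(N - 1).choose L`, which is
the sum in the bound. Otherwise one counts inner nodes: a binary tree with `k` leaves has `k - 1`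
of them.
-/

namespace BFAS

variable {N M L : ℕ}

/-! ### Nodes of the search tree -/

namespace Node

/-- The nodes that have a leaf among their descendants: at most `L` antennas are activated and at
most `N - L` are shut down. -/
structure Admissible (L : ℕ) (ν : Node N) : Prop where
  disjoint : Disjoint ν.A ν.B
  card_A_le : ν.A.card ≤ L
  card_B_le : ν.B.card ≤ N - L

/-- The nodes that occur in a run, that is, the admissible nodes to which `Node.complete` has
been applied. -/
structure Valid (L : ℕ) (ν : Node N) : Prop extends ν.Admissible L where
  lt_of_not_isLeaf : ¬ ν.IsLeaf L → ν.A.card < L ∧ ν.B.card < N - L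

/-- The set `T` of antennas that a leaf shuts down is compatible with a node if the leaf may be a
descendant of the node. -/
def Compatible (ν : Node N) (T : Finset (Fin N)) : Prop := ν.B ⊆ T ∧ Disjoint ν.A T

variable {ν : Node N} {n : Fin N} {T : Finset (Fin N)}

theorem mem_undecided : n ∈ ν.undecided ↔ n ∉ ν.A ∧ n ∉ ν.B := by
  simp only [undecided, Finset.mem_compl, Finset.mem_union, not_or]

theorem card_undecided_add (h : Disjoint ν.A ν.B) :
    ν.undecided.card + (ν.A.card + ν.B.card) = N := by
  rw [undecided, ← Finset.card_union_of_disjoint h, Finset.card_compl_add_card, Fintype.card_fin]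

theorem undecided_insert_B (ν : Node N) (n : Fin N) :
    undecided ⟨ν.A, insert n ν.B⟩ = ν.undecided.erase n := by
  ext i
  simp only [mem_undecided, Finset.mem_insert, Finset.mem_erase]
  tauto

theorem undecided_insert_A (ν : Node N) (n : Fin N) :
    undecided ⟨insert n ν.A, ν.B⟩ = ν.undecided.erase n := by
  ext i
  simp only [mem_undecided, Finset.mem_insert, Finset.mem_erase]
  tauto

theorem undecided_complete_subset (L : ℕ) (ν : Node N) :
    (ν.complete L).undecided ⊆ ν.undecided := by
  unfold complete
  split_ifs <;> simp [undecided]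

theorem card_undecided_left_lt (hn : n ∈ ν.undecided) :
    (ν.left L n).undecided.card < ν.undecided.card :=
  (Finset.card_le_card (undecided_complete_subset L _)).trans_lt <| by
    rw [undecided_insert_B]
    exact Finset.card_erase_lt_of_mem hn

theorem card_undecided_right_lt (hn : n ∈ ν.undecided) :
    (ν.right L n).undecided.card < ν.undecided.card :=
  (Finset.card_le_card (undecided_complete_subset L _)).trans_lt <| by
    rw [undecided_insert_A]
    exact Finset.card_erase_lt_of_mem hn

namespace Admissible

theorem A_eq_compl_of_isLeaf (h : ν.Admissible L) (hl : ν.IsLeaf L) : ν.A = ν.Bᶜ := by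
  refine Finset.eq_of_subset_of_card_le (Finset.subset_compl_iff_disjoint_right.2 h.disjoint) ?_
  rw [Finset.card_compl, Fintype.card_fin, hl.1, hl.2]
  omega

theorem card_undecided_of_isLeaf (h : ν.Admissible L) (hl : ν.IsLeaf L) :
    ν.undecided.card = 0 := by
  rw [undecided, h.A_eq_compl_of_isLeaf hl, Finset.union_comm, Finset.union_compl,
    Finset.compl_univ, Finset.card_empty]

theorem isLeaf_complete_or_complete_eq (hLN : L ≤ N) (h : ν.Admissible L) :
    ((ν.complete L).IsLeaf L ∧ Disjoint (ν.complete L).A (ν.complete L).B) ∨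
      (ν.complete L = ν ∧ ν.A.card < L ∧ ν.B.card < N - L) := by
  unfold complete
  split_ifs with hA hB
  · exact Or.inl ⟨⟨hA, by simp [Finset.card_compl, hA]⟩, disjoint_compl_right⟩
  · refine Or.inl ⟨⟨?_, hB⟩, disjoint_compl_left⟩
    rw [Finset.card_compl, Fintype.card_fin, hB, Nat.sub_sub_self hLN]
  · exact Or.inr ⟨rfl, h.card_A_le.lt_of_ne hA, h.card_B_le.lt_of_ne hB⟩

theorem complete_eq_self (hLN : L ≤ N) (h : ν.Admissible L) (hl : ¬ (ν.complete L).IsLeaf L) :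
    ν.complete L = ν :=
  ((h.isLeaf_complete_or_complete_eq hLN).resolve_left fun h' => hl h'.1).1

theorem valid_complete (hLN : L ≤ N) (h : ν.Admissible L) : (ν.complete L).Valid L := by
  rcases h.isLeaf_complete_or_complete_eq hLN with ⟨hl, hd⟩ | ⟨heq, hlt⟩
  · exact ⟨⟨hd, hl.1.le, hl.2.le⟩, fun hl' => absurd hl hl'⟩
  · rw [heq]
    exact ⟨h, fun _ => hlt⟩

end Admissible

namespace Valid

theorem admissible_insert_B (h : ν.Valid L) (hl : ¬ ν.IsLeaf L) (hn : n ∈ ν.undecided) :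
    Admissible L ⟨ν.A, insert n ν.B⟩ where
  disjoint := Finset.disjoint_insert_right.2 ⟨(mem_undecided.1 hn).1, h.disjoint⟩
  card_A_le := h.card_A_le
  card_B_le := (Finset.card_insert_le _ _).trans (h.lt_of_not_isLeaf hl).2

theorem admissible_insert_A (h : ν.Valid L) (hl : ¬ ν.IsLeaf L) (hn : n ∈ ν.undecided) :
    Admissible L ⟨insert n ν.A, ν.B⟩ where
  disjoint := Finset.disjoint_insert_left.2 ⟨(mem_undecided.1 hn).2, h.disjoint⟩
  card_A_le := (Finset.card_insert_le _ _).trans (h.lt_of_not_isLeaf hl).1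
  card_B_le := h.card_B_le

theorem left (hLN : L ≤ N) (h : ν.Valid L) (hl : ¬ ν.IsLeaf L) (hn : n ∈ ν.undecided) :
    (ν.left L n).Valid L :=
  (h.admissible_insert_B hl hn).valid_complete hLN

theorem right (hLN : L ≤ N) (h : ν.Valid L) (hl : ¬ ν.IsLeaf L) (hn : n ∈ ν.undecided) :
    (ν.right L n).Valid L :=
  (h.admissible_insert_A hl hn).valid_complete hLN

theorem lt_card_undecided (h : ν.Valid L) (hl : ¬ ν.IsLeaf L) :
    L - ν.A.card < ν.undecided.card := by
  have hlt := h.lt_of_not_isLeaf hl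
  have hsum := card_undecided_add h.disjoint
  omega

end Valid

theorem admissible_empty (N L : ℕ) : Admissible L (⟨∅, ∅⟩ : Node N) :=
  ⟨Finset.disjoint_empty_left _, Nat.zero_le _, Nat.zero_le _⟩

theorem valid_root (hLN : L ≤ N) : (root N L).Valid L :=
  (admissible_empty N L).valid_complete hLN

theorem Compatible.complete (hLN : L ≤ N) (hT : T.card = N - L) (h : ν.Compatible T) :
    (ν.complete L).Compatible T := by
  unfold Node.complete
  split_ifs with hA hB
  · have hAT : ν.A = Tᶜ :=
      Finset.eq_of_subset_of_card_le (Finset.subset_compl_iff_disjoint_right.2 h.2) <| by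
        rw [Finset.card_compl, Fintype.card_fin, hT, hA, Nat.sub_sub_self hLN]
    exact ⟨by rw [hAT, compl_compl], h.2⟩
  · have hBT : ν.B = T := Finset.eq_of_subset_of_card_le h.1 (hT.trans hB.symm).le
    exact ⟨h.1, by rw [hBT]; exact disjoint_compl_left⟩
  · exact h

theorem compatible_root (hLN : L ≤ N) (hT : T.card = N - L) : (root N L).Compatible T :=
  Compatible.complete hLN hT ⟨Finset.empty_subset _, Finset.disjoint_empty_left _⟩

theorem Compatible.left_or_right (hLN : L ≤ N) (hT : T.card = N - L) (h : ν.Compatible T)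
    (n : Fin N) : (ν.left L n).Compatible T ∨ (ν.right L n).Compatible T := by
  by_cases hn : n ∈ T
  · exact Or.inl (Compatible.complete hLN hT ⟨Finset.insert_subset hn h.1, h.2⟩)
  · exact Or.inr (Compatible.complete hLN hT ⟨h.1, Finset.disjoint_insert_left.2 ⟨hn, h.2⟩⟩)

end Node

/-! ### Selection rules -/

theorem exists_smallest_subset {α β : Type*} [DecidableEq α] [LinearOrder β] (U : Finset α)
    (f : α → β) {k : ℕ} (hk : k ≤ U.card) :
    ∃ V ⊆ U, V.card = k ∧ ∀ i ∈ V, ∀ j ∈ U \ V, f i ≤ f j := by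
  induction k with
  | zero => exact ⟨∅, by simp⟩
  | succ k ih =>
    obtain ⟨V, hVU, hV, hmin⟩ := ih (Nat.le_of_succ_le hk)
    have hne : (U \ V).Nonempty := by
      rw [← Finset.card_pos, Finset.card_sdiff_of_subset hVU]
      omega
    obtain ⟨a, ha, hamin⟩ := Finset.exists_min_image (U \ V) f hne
    obtain ⟨haU, haV⟩ := Finset.mem_sdiff.1 ha
    refine ⟨insert a V, Finset.insert_subset haU hVU, by
      rw [Finset.card_insert_of_notMem haV, hV], fun i hi j hj => ?_⟩
    have hj' : j ∈ U \ V :=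
      Finset.sdiff_subset_sdiff Finset.Subset.rfl (Finset.subset_insert a V) hj
    rcases Finset.mem_insert.1 hi with rfl | hi
    · exact hamin j hj'
    · exact hmin i hi j hj'

theorem Node.Admissible.exists_excludeSmallest {X : Type} {ν : Node N} (h : ν.Admissible L)
    (p : X → Fin N → ℝ) (x : X) :
    ∃ T, ν.B ⊆ T ∧ T ⊆ ν.B ∪ ν.undecided ∧ T.card = N - L ∧ excludeSmallest p ν x T := by
  have hcard := Node.card_undecided_add h.disjoint
  have hA := h.card_A_le
  have hB := h.card_B_le
  obtain ⟨V, hVU, hV, hmin⟩ :=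
    exists_smallest_subset ν.undecided (p x) (k := N - L - ν.B.card) (by omega)
  have hd : Disjoint ν.B V := Finset.disjoint_left.2 fun i hi hiV =>
    (Node.mem_undecided.1 (hVU hiV)).2 hi
  refine ⟨ν.B ∪ V, Finset.subset_union_left, Finset.union_subset_union_right hVU, ?_, ?_⟩
  · rw [Finset.card_union_of_disjoint hd, hV, Nat.add_sub_cancel' hB]
  · intro i hi j hj
    rw [Finset.union_sdiff_cancel_left hd] at hi
    exact hmin i hi j (Finset.sdiff_subset_sdiff Finset.Subset.rfl Finset.subset_union_right hj)

namespace Method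

variable {κ X : Type}

/-- The selection rules of a method never get stuck: whatever the lower bound solution is, there
is an admissible branching antenna and an admissible set of antennas to shut down. -/
structure CanSelect (E : Method N M κ X) (L : ℕ) : Prop where
  exists_branch : ∀ (ν : Node N) (x : X), ν.undecided.Nonempty →
    ∃ n ∈ ν.undecided, E.mayBranch ν x n
  exists_exclude : ∀ (ν : Node N) (x : X), ν.Admissible L →
    ∃ T, ν.B ⊆ T ∧ T ⊆ ν.B ∪ ν.undecided ∧ T.card = N - L ∧ E.mayExclude ν x T

theorem canSelect_socpBB (solve : Finset (Fin N) → Option (Beam N M)) :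
    (socpBB solve).CanSelect L :=
  ⟨fun ν x hν => Finset.exists_max_image ν.undecided (rowPower x) hν,
    fun _ x h => h.exists_excludeSmallest rowPower x⟩

theorem canSelect_sdrBB (solve : Finset (Fin N) → Option (Lifted N M)) :
    (sdrBB solve).CanSelect L :=
  ⟨fun ν x hν => Finset.exists_max_image ν.undecided (liftedRowPower x) hν,
    fun _ x h => h.exists_excludeSmallest liftedRowPower x⟩

theorem canSelect_of_forall_may {E : Method N M κ X} (hbranch : ∀ ν x n, E.mayBranch ν x n)
    (hexclude : ∀ ν x T, E.mayExclude ν x T) : E.CanSelect L where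
  exists_branch ν x hν := hν.imp fun n hn => ⟨hn, hbranch ν x n⟩
  exists_exclude ν x h := by
    obtain ⟨T, hBT, hTB, hT, -⟩ := h.exists_excludeSmallest (fun (_ : X) _ => 0) x
    exact ⟨T, hBT, hTB, hT, hexclude ν x T⟩

theorem CanSelect.exists_excludes {E : Method N M κ X} (hE : E.CanSelect L) {ν : Node N}
    (h : ν.Admissible L) : ∃ o, E.Excludes L ν o := by
  cases hs : E.solve (E.lbKey ν) with
  | none => exact ⟨none, hs⟩
  | some x =>
    obtain ⟨T, hBT, hTB, hT, hmay⟩ := hE.exists_exclude ν x h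
    exact ⟨some T, hBT, hTB, hT, x, hs, hmay⟩


/-! ### Runs -/

theorem sum_insert_le {α : Type*} [DecidableEq α] (a : α) (F : Finset α) (f : α → ℕ) :
    ∑ i ∈ insert a F, f i ≤ f a + ∑ i ∈ F, f i := by
  by_cases h : a ∈ F
  · simp [Finset.insert_eq_of_mem h]
  · rw [Finset.sum_insert h]

section Next

variable (E : Method N M κ X) (s : State N M κ) (ν ν₁ ν₂ : Node N) (W : Option (Beam N M))
  (c : Finset κ × ℕ)

theorem upper_next : (E.next s ν ν₁ ν₂ W c).upper = min (cost W) s.upper :=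
  (min_def _ _).symm

theorem mem_frontier_next {ν' : Node N} :
    ν' ∈ (E.next s ν ν₁ ν₂ W c).frontier ↔
      (ν' = ν₁ ∨ ν' = ν₂ ∨ ν' ≠ ν ∧ ν' ∈ s.frontier) ∧
        E.lb ν' ≤ (E.next s ν ν₁ ν₂ W c).upper := by
  simp only [next, Finset.mem_filter, Finset.mem_insert, Finset.mem_erase]

variable {E s ν ν₁ ν₂ W c}

theorem forall_mem_frontier_next {p : Node N → Prop} (h₁ : p ν₁) (h₂ : p ν₂)
    (hs : ∀ ν' ∈ s.frontier, p ν') : ∀ ν' ∈ (E.next s ν ν₁ ν₂ W c).frontier, p ν' := by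
  intro ν' hν'
  rcases ((E.mem_frontier_next s ν ν₁ ν₂ W c).1 hν').1 with rfl | rfl | ⟨-, hν'⟩
  · exact h₁
  · exact h₂
  · exact hs ν' hν'

theorem sum_frontier_next_le (hν : ν ∈ s.frontier) (f : Node N → ℕ) :
    ∑ ν' ∈ (E.next s ν ν₁ ν₂ W c).frontier, f ν' + f ν ≤
      f ν₁ + f ν₂ + ∑ ν' ∈ s.frontier, f ν' := by
  have hfilter : ∑ ν' ∈ (E.next s ν ν₁ ν₂ W c).frontier, f ν' ≤
      ∑ ν' ∈ insert ν₁ (insert ν₂ (s.frontier.erase ν)), f ν' :=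
    Finset.sum_le_sum_of_subset (Finset.filter_subset _ _)
  have h₁ := sum_insert_le ν₁ (insert ν₂ (s.frontier.erase ν)) f
  have h₂ := sum_insert_le ν₂ (s.frontier.erase ν) f
  have herase := Finset.sum_erase_add s.frontier f hν
  omega

theorem lower_next_le {ν' : Node N} (h : ν' ∈ (E.next s ν ν₁ ν₂ W c).frontier) :
    (E.next s ν ν₁ ν₂ W c).lower ≤ E.lb ν' :=
  Finset.inf_le (f := E.lb) (Finset.mem_filter.1 h).1

theorem exists_lb_eq_lower_next
    (h : (E.next s ν ν₁ ν₂ W c).lower ≤ (E.next s ν ν₁ ν₂ W c).upper) :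
    ∃ ν' ∈ (E.next s ν ν₁ ν₂ W c).frontier, E.lb ν' = (E.next s ν ν₁ ν₂ W c).lower := by
  obtain ⟨ν', hν', heq⟩ := Finset.exists_mem_eq_inf
    (insert ν₁ (insert ν₂ (s.frontier.erase ν))) ⟨_, Finset.mem_insert_self _ _⟩ E.lb
  exact ⟨ν', Finset.mem_filter.2 ⟨hν', heq.ge.trans h⟩, heq.symm⟩

theorem upper_next_eq_cost (h : s.upper = cost s.incumbent) :
    (E.next s ν ν₁ ν₂ W c).upper = cost (E.next s ν ν₁ ν₂ W c).incumbent := by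
  unfold next
  dsimp only
  split_ifs
  · rfl
  · exact h

theorem forall_incumbent_next {p : Beam N M → Prop} (hW : ∀ V, W = some V → p V)
    (hs : ∀ V, s.incumbent = some V → p V) :
    ∀ V, (E.next s ν ν₁ ν₂ W c).incumbent = some V → p V := by
  unfold next
  dsimp only
  split_ifs
  · exact hW
  · exact hs

end Next

/-- A measure of the work left in a state of a run, which every iteration decreases. The base `3`
leaves room for the two children of the branched node. -/
def searchSize (s : State N M κ) : ℕ := ∑ ν ∈ s.frontier, 3 ^ ν.undecided.card

variable [DecidableEq κ] {E : Method N M κ X} {tol : ℝ≥0} {s s' : State N M κ}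

theorem searchSize_lt_of_step (h : E.Step L tol s s') : searchSize s' < searchSize s := by
  obtain ⟨-, ν, hν, -, -, x, -, n, hn, -, o₁, o₂, -, -, W, -, -, -, rfl⟩ := h
  obtain ⟨k, hk⟩ : ∃ k, ν.undecided.card = k + 1 :=
    Nat.exists_eq_add_one.2 (Finset.card_pos.2 ⟨n, hn⟩)
  have pow_le {ν' : Node N} (h : ν'.undecided.card < ν.undecided.card) :
      3 ^ ν'.undecided.card ≤ 3 ^ k := Nat.pow_le_pow_right (by norm_num) (by omega)
  have hleft := pow_le (Node.card_undecided_left_lt (L := L) hn)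
  have hright := pow_le (Node.card_undecided_right_lt (L := L) hn)
  have hpos : 0 < 3 ^ k := by positivity
  have hsum := sum_frontier_next_le (E := E) (ν₁ := ν.left L n) (ν₂ := ν.right L n) (W := W)
    (c := E.evaluate (E.evaluate (s.cache, s.calls) (ν.left L n) o₁) (ν.right L n) o₂) hν
    fun ν => 3 ^ ν.undecided.card
  simp only [hk, pow_succ] at hsum
  unfold searchSize
  omega

theorem CanSelect.terminates (hE : E.CanSelect L) (hLN : L ≤ N) (tol : ℝ≥0) :
    E.Terminates L tol := by
  refine ⟨?_, ?_⟩
  · obtain ⟨o, ho⟩ := hE.exists_excludes (Node.valid_root hLN).toAdmissible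
    exact ⟨_, o, ho, rfl⟩
  · rintro ⟨s, -, hs⟩
    exact not_strictAnti_of_wellFoundedLT (fun t => searchSize (s t))
      (strictAnti_nat_of_succ_lt fun t => searchSize_lt_of_step (hs t))

theorem Reachable.induction {p : State N M κ → Prop} (init : ∀ s, E.Initial L s → p s)
    (step : ∀ s s', E.Reachable L tol s → p s → E.Step L tol s s' → p s')
    (hs : E.Reachable L tol s) : p s := by
  obtain ⟨s₀, h₀, h⟩ := hs
  induction h with
  | refl => exact init s₀ h₀
  | tail h hstep ih => exact step _ _ ⟨s₀, h₀, h⟩ ih hstep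

theorem Reachable.valid (hLN : L ≤ N) (hs : E.Reachable L tol s) :
    ∀ ν ∈ s.frontier, ν.Valid L := by
  refine hs.induction (p := fun s => ∀ ν ∈ s.frontier, ν.Valid L) (fun s hs => ?_)
    fun s s' _ ih h => ?_
  · obtain ⟨o, -, rfl⟩ := hs
    simpa only [Finset.mem_singleton, forall_eq] using Node.valid_root hLN
  · obtain ⟨-, ν, hν, hl, -, x, -, n, hn, -, o₁, o₂, -, -, W, -, -, -, rfl⟩ := h
    exact forall_mem_frontier_next ((ih ν hν).left hLN hl hn) ((ih ν hν).right hLN hl hn) ih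

/-! ### Counting the programs solved in a run -/

theorem query_fst (c : Finset κ × ℕ) (k : κ) : (query c k).1 = insert k c.1 := by
  unfold query
  split_ifs with h
  · exact (Finset.insert_eq_of_mem h).symm
  · rfl

theorem query_snd {c : Finset κ × ℕ} (hc : c.2 = c.1.card) (k : κ) :
    (query c k).2 = (query c k).1.card := by
  unfold query
  split_ifs with h
  · exact hc
  · rw [Finset.card_insert_of_notMem h, hc]

theorem evaluate_snd (E : Method N M κ X) {c : Finset κ × ℕ} (hc : c.2 = c.1.card) (ν : Node N)
    (o : Option (Finset (Fin N))) : (E.evaluate c ν o).2 = (E.evaluate c ν o).1.card := by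
  cases o with
  | none => exact query_snd hc _
  | some T => exact query_snd (query_snd hc _) _

theorem insert_lbKey_subset_evaluate (E : Method N M κ X) (c : Finset κ × ℕ) (ν : Node N)
    (o : Option (Finset (Fin N))) : insert (E.lbKey ν) c.1 ⊆ (E.evaluate c ν o).1 := by
  cases o with
  | none => exact (query_fst c _).ge
  | some T =>
    simp only [evaluate, query_fst]
    exact Finset.subset_insert _ _

theorem evaluate_subset {K : Finset κ} (hK : ∀ T : Finset (Fin N), T.card = N - L → E.ubKey T ∈ K)
    (c : Finset κ × ℕ) {ν : Node N} {o : Option (Finset (Fin N))} (ho : E.Excludes L ν o) :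
    (E.evaluate c ν o).1 ⊆ insert (E.lbKey ν) c.1 ∪ K := by
  cases o with
  | none => exact (query_fst c _).le.trans Finset.subset_union_left
  | some T =>
    simp only [evaluate, query_fst]
    exact Finset.insert_subset (Finset.mem_union_right _ (hK T ho.2.2.1)) Finset.subset_union_left

/-- A budget for the number of programs solved in a run: `K` contains the programs of the leaves,
and `g ν` bounds the number of other programs that branching below `ν` adds to the program of
`ν`. -/
structure CountBound (E : Method N M κ X) (L : ℕ) (K : Finset κ) (g : Node N → ℕ) : Prop where
  ubKey_mem : ∀ T : Finset (Fin N), T.card = N - L → E.ubKey T ∈ K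
  branch : ∀ ν : Node N, ν.Valid L → ¬ ν.IsLeaf L → ∀ n ∈ ν.undecided,
    (({E.lbKey (ν.left L n), E.lbKey (ν.right L n)} : Finset κ) \ insert (E.lbKey ν) K).card +
      g (ν.left L n) + g (ν.right L n) ≤ g ν

/-- The invariant of the counting argument: the programs solved so far outside of `K`, together
with the budgets of the unbranched nodes, do not exceed the budget of the root. -/
structure CountInvariant (E : Method N M κ X) (L : ℕ) (K : Finset κ) (g : Node N → ℕ)
    (s : State N M κ) : Prop where
  calls_eq : s.calls = s.cache.card
  lbKey_mem : ∀ ν ∈ s.frontier, E.lbKey ν ∈ s.cache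
  bound : (s.cache \ K).card + ∑ ν ∈ s.frontier, g ν ≤
    (({E.lbKey (Node.root N L)} : Finset κ) \ K).card + g (Node.root N L)

namespace CountBound

variable {K : Finset κ} {g : Node N → ℕ}

theorem invariant_of_initial (hE : E.CountBound L K g) (hs : E.Initial L s) :
    E.CountInvariant L K g s := by
  obtain ⟨o, ho, rfl⟩ := hs
  refine ⟨E.evaluate_snd rfl _ _, ?_, ?_⟩
  · simpa only [Finset.mem_singleton, forall_eq] using
      E.insert_lbKey_subset_evaluate (∅, 0) _ o (Finset.mem_insert_self _ _)
  · rw [Finset.sum_singleton]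
    have hsub := Finset.sdiff_subset_sdiff (evaluate_subset hE.ubKey_mem (∅, 0) ho)
      (Finset.Subset.refl K)
    rw [Finset.union_sdiff_right] at hsub
    exact Nat.add_le_add_right (Finset.card_le_card hsub) _

theorem card_evaluate_evaluate_sdiff_le (hE : E.CountBound L K g) {c : Finset κ × ℕ} {k : κ}
    (hk : k ∈ c.1) {ν₁ ν₂ : Node N} {o₁ o₂ : Option (Finset (Fin N))}
    (h₁ : E.Excludes L ν₁ o₁) (h₂ : E.Excludes L ν₂ o₂) :
    ((E.evaluate (E.evaluate c ν₁ o₁) ν₂ o₂).1 \ K).card ≤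
      (c.1 \ K).card + (({E.lbKey ν₁, E.lbKey ν₂} : Finset κ) \ insert k K).card := by
  refine (Finset.card_le_card fun i hi => ?_).trans (Finset.card_union_le _ _)
  obtain ⟨hi, hiK⟩ := Finset.mem_sdiff.1 hi
  have hi₂ := evaluate_subset hE.ubKey_mem _ h₂ hi
  have hi₁ : i ∈ (E.evaluate c ν₁ o₁).1 → _ := fun h => evaluate_subset hE.ubKey_mem c h₁ h
  simp only [Finset.mem_union, Finset.mem_sdiff, Finset.mem_insert, Finset.mem_singleton]
    at hi₁ hi₂ ⊢
  by_cases hik : i = k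
  · exact Or.inl ⟨hik ▸ hk, hiK⟩
  · tauto

theorem invariant_of_step (hE : E.CountBound L K g) (hv : ∀ ν ∈ s.frontier, ν.Valid L)
    (hs : E.CountInvariant L K g s) (h : E.Step L tol s s') : E.CountInvariant L K g s' := by
  obtain ⟨-, ν, hν, hl, -, x, -, n, hn, -, o₁, o₂, ho₁, ho₂, W, -, -, -, rfl⟩ := h
  have hc₁ := E.insert_lbKey_subset_evaluate (s.cache, s.calls) (ν.left L n) o₁
  have hc₂ := E.insert_lbKey_subset_evaluate (E.evaluate (s.cache, s.calls) (ν.left L n) o₁)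
    (ν.right L n) o₂
  have hc := hc₁.trans ((Finset.subset_insert _ _).trans hc₂)
  refine ⟨E.evaluate_snd (E.evaluate_snd hs.calls_eq _ _) _ _, ?_, ?_⟩
  · exact forall_mem_frontier_next (hc (Finset.mem_insert_self _ _))
      (hc₂ (Finset.mem_insert_self _ _))
      fun ν' hν' => hc (Finset.mem_insert_of_mem (hs.lbKey_mem ν' hν'))
  · have hsum := sum_frontier_next_le (E := E) (ν₁ := ν.left L n) (ν₂ := ν.right L n) (W := W)
      (c := E.evaluate (E.evaluate (s.cache, s.calls) (ν.left L n) o₁) (ν.right L n) o₂) hν g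
    have hcache := hE.card_evaluate_evaluate_sdiff_le (c := (s.cache, s.calls))
      (hs.lbKey_mem ν hν) ho₁ ho₂
    have hbranch := hE.branch ν (hv ν hν) hl n hn
    have hbound := hs.bound
    change (Finset.card (_ \ K)) + _ ≤ _
    dsimp only [next] at hsum hcache ⊢
    omega

theorem solvesAtMost (hE : E.CountBound L K g) (hsel : E.CanSelect L) (hLN : L ≤ N) (tol : ℝ≥0) :
    E.SolvesAtMost L tol (K.card +
      ((({E.lbKey (Node.root N L)} : Finset κ) \ K).card + g (Node.root N L))) := by
  refine ⟨hsel.terminates hLN tol, fun s hs => ?_⟩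
  have hinv : E.CountInvariant L K g s :=
    hs.induction (fun _ => hE.invariant_of_initial)
      fun _ _ hs ih h => hE.invariant_of_step (hs.valid hLN) ih h
  calc s.calls = s.cache.card := hinv.calls_eq
    _ ≤ (K ∪ (s.cache \ K)).card := Finset.card_le_card (by simp [Finset.subset_union_right])
    _ ≤ K.card + (s.cache \ K).card := Finset.card_union_le _ _
    _ ≤ _ := Nat.add_le_add_left ((Nat.le_add_right _ _).trans hinv.bound) _

end CountBound

end Method

/-! ### Number of programs solved by the two kinds of methods -/

theorem sum_Icc_choose_sub (hL : 1 ≤ L) (hLN : L ≤ N) :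
    ∑ i ∈ Finset.Icc 2 (N - L + 1), (N - i).choose (L - 1) = (N - 1).choose L := by
  obtain ⟨l, rfl⟩ := Nat.exists_eq_add_of_le' hL
  rcases Nat.lt_or_ge N 2 with hN | hN
  · obtain rfl : N = 1 := by omega
    obtain rfl : l = 0 := by omega
    rfl
  obtain ⟨n, rfl⟩ := Nat.exists_eq_add_of_le' hN
  refine Eq.trans ?_ (Nat.sum_Icc_choose n l)
  refine Finset.sum_nbij' (fun i => n + 2 - i) (fun i => n + 2 - i) ?_ ?_ ?_ ?_ fun _ _ => rfl
  all_goals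
    intro i hi
    simp only [Finset.mem_Icc] at hi ⊢
    omega

theorem two_le_choose {n k : ℕ} (hk : 1 ≤ k) (hkn : k < n) : 2 ≤ n.choose k := by
  obtain ⟨k, rfl⟩ := Nat.exists_eq_add_of_le' hk
  obtain ⟨n, rfl⟩ := Nat.exists_eq_add_of_le' (Nat.one_le_of_lt hkn)
  rw [Nat.choose_succ_succ']
  have h₀ : 0 < n.choose k := Nat.choose_pos (by omega)
  have h₁ : 0 < n.choose (k + 1) := Nat.choose_pos (by omega)
  omega

namespace Node

/-- The number of programs below `ν` that are neither the program of `ν` nor that of a leaf, when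
programs are indexed by the set of antennas shut down. Only a child that shuts down an antenna
needs a new program, so Pascal's rule loses one of its two summands at each level. -/
def shutDownBudget (L : ℕ) (ν : Node N) : ℕ := (ν.undecided.card - 1).choose (L - ν.A.card) - 1

/-- The number of programs below `ν` that are neither the program of `ν` nor that of a leaf, when
each node has a program of its own: a binary tree with `k` leaves has `k - 1` inner nodes. -/
def decisionBudget (L : ℕ) (ν : Node N) : ℕ := ν.undecided.card.choose (L - ν.A.card) - 2

/-- All leaves of the search tree. -/
def leaves (N L : ℕ) : Finset (Node N) :=
  (Finset.powersetCard (N - L) Finset.univ).image fun T => ⟨Tᶜ, T⟩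

variable {ν : Node N}

theorem mem_leaves : ν ∈ leaves N L ↔ ν.A = ν.Bᶜ ∧ ν.B.card = N - L := by
  simp only [leaves, Finset.mem_image, Finset.mem_powersetCard_univ]
  constructor
  · rintro ⟨T, hT, rfl⟩
    exact ⟨rfl, hT⟩
  · rintro ⟨hA, hB⟩
    exact ⟨ν.B, hB, by rw [← hA]⟩

theorem card_leaves_le (hLN : L ≤ N) : (leaves N L).card ≤ N.choose L :=
  Finset.card_image_le.trans <| by
    rw [Finset.card_powersetCard, Finset.card_univ, Fintype.card_fin, Nat.choose_symm hLN]

namespace Admissible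

theorem mem_leaves_of_isLeaf (h : ν.Admissible L) (hl : ν.IsLeaf L) : ν ∈ leaves N L :=
  mem_leaves.2 ⟨h.A_eq_compl_of_isLeaf hl, hl.2⟩

theorem shutDownBudget_eq_zero_of_isLeaf (h : ν.Admissible L) (hl : ν.IsLeaf L) :
    shutDownBudget L ν = 0 := by
  simp [shutDownBudget, h.card_undecided_of_isLeaf hl, hl.1]

theorem decisionBudget_eq_zero_of_isLeaf (h : ν.Admissible L) (hl : ν.IsLeaf L) :
    decisionBudget L ν = 0 := by
  simp [decisionBudget, h.card_undecided_of_isLeaf hl, hl.1]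

theorem shutDownBudget_complete_le (hLN : L ≤ N) (h : ν.Admissible L) :
    shutDownBudget L (ν.complete L) ≤ (ν.undecided.card - 1).choose (L - ν.A.card) - 1 := by
  by_cases hl : (ν.complete L).IsLeaf L
  · rw [(h.valid_complete hLN).shutDownBudget_eq_zero_of_isLeaf hl]
    exact Nat.zero_le _
  · rw [h.complete_eq_self hLN hl, shutDownBudget]

theorem card_sdiff_add_shutDownBudget_le (hLN : L ≤ N) (h : ν.Admissible L) :
    (({(ν.complete L).B} : Finset (Finset (Fin N))) \
        Finset.powersetCard (N - L) Finset.univ).card + shutDownBudget L (ν.complete L) ≤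
      (ν.undecided.card - 1).choose (L - ν.A.card) := by
  have hv := h.valid_complete hLN
  by_cases hl : (ν.complete L).IsLeaf L
  · rw [hv.shutDownBudget_eq_zero_of_isLeaf hl, Finset.sdiff_eq_empty_iff_subset.2 <|
      Finset.singleton_subset_iff.2 (Finset.mem_powersetCard_univ.2 hl.2)]
    exact Nat.zero_le _
  · have heq := h.complete_eq_self hLN hl
    rw [heq] at hv hl ⊢
    have hpos : 0 < (ν.undecided.card - 1).choose (L - ν.A.card) :=
      Nat.choose_pos (Nat.le_sub_one_of_lt (hv.lt_card_undecided hl))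
    have hcard := Finset.card_singleton ν.B ▸ Finset.card_le_card
      (Finset.sdiff_subset (s := {ν.B}) (t := Finset.powersetCard (N - L) Finset.univ))
    rw [shutDownBudget]
    omega

theorem card_sdiff_leaves_add_decisionBudget_le (hLN : L ≤ N) (h : ν.Admissible L) :
    (({ν.complete L} : Finset (Node N)) \ leaves N L).card + decisionBudget L (ν.complete L) ≤
      ν.undecided.card.choose (L - ν.A.card) - 1 := by
  have hv := h.valid_complete hLN
  by_cases hl : (ν.complete L).IsLeaf L
  · rw [hv.decisionBudget_eq_zero_of_isLeaf hl, Finset.sdiff_eq_empty_iff_subset.2 <|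
      Finset.singleton_subset_iff.2 (hv.mem_leaves_of_isLeaf hl)]
    exact Nat.zero_le _
  · have heq := h.complete_eq_self hLN hl
    rw [heq] at hv hl ⊢
    have hA := (hv.lt_of_not_isLeaf hl).1
    have htwo : 2 ≤ ν.undecided.card.choose (L - ν.A.card) :=
      two_le_choose (by omega) (hv.lt_card_undecided hl)
    have hcard := Finset.card_singleton ν ▸ Finset.card_le_card
      (Finset.sdiff_subset (s := {ν}) (t := leaves N L))
    rw [decisionBudget]
    omega

end Admissible

theorem Valid.right_B_mem (hLN : L ≤ N) (h : ν.Valid L) (hl : ¬ ν.IsLeaf L) {n : Fin N}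
    (hn : n ∈ ν.undecided) :
    (ν.right L n).B ∈ insert ν.B (Finset.powersetCard (N - L) Finset.univ) := by
  by_cases hleaf : (ν.right L n).IsLeaf L
  · exact Finset.mem_insert_of_mem (Finset.mem_powersetCard_univ.2 hleaf.2)
  · rw [Node.right, (h.admissible_insert_A hl hn).complete_eq_self hLN hleaf]
    exact Finset.mem_insert_self _ _

theorem Valid.exists_card_undecided_eq (h : ν.Valid L) (hl : ¬ ν.IsLeaf L) {n : Fin N}
    (hn : n ∈ ν.undecided) :
    ∃ u l, l < u ∧ (ν.undecided.erase n).card = u ∧ ν.undecided.card = u + 1 ∧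
      L - ν.A.card = l + 1 ∧ L - (insert n ν.A).card = l := by
  have hA := (h.lt_of_not_isLeaf hl).1
  have hu := h.lt_card_undecided hl
  rw [Finset.card_erase_of_mem hn, Finset.card_insert_of_notMem (mem_undecided.1 hn).1]
  exact ⟨ν.undecided.card - 1, L - ν.A.card - 1, by omega⟩

end Node

namespace Method

variable {X : Type}

theorem countBound_shutDownBudget {E : Method N M (Finset (Fin N)) X} (hlb : E.lbKey = Node.B)
    (hub : E.ubKey = id) (hLN : L ≤ N) :
    E.CountBound L (Finset.powersetCard (N - L) Finset.univ) (Node.shutDownBudget L) := by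
  refine ⟨fun T hT => by rwa [hub, Finset.mem_powersetCard_univ], fun ν hv hl n hn => ?_⟩
  set K : Finset (Finset (Fin N)) := Finset.powersetCard (N - L) Finset.univ
  have hnew : ({(ν.left L n).B, (ν.right L n).B} : Finset (Finset (Fin N))) \ insert ν.B K ⊆
      {(ν.left L n).B} \ K := by
    have hright := hv.right_B_mem hLN hl hn
    intro T hT
    simp only [Finset.mem_sdiff, Finset.mem_insert, Finset.mem_singleton] at hT hright ⊢
    rcases hT with ⟨rfl | rfl, hT⟩
    · tauto
    · exact absurd hright hT
  have hleft := (hv.admissible_insert_B hl hn).card_sdiff_add_shutDownBudget_le hLN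
  have hright := (hv.admissible_insert_A hl hn).shutDownBudget_complete_le hLN
  obtain ⟨u, l, hlu, herase, hu, hA, hA'⟩ := hv.exists_card_undecided_eq hl hn
  obtain ⟨u, rfl⟩ := Nat.exists_eq_add_of_lt hlu
  rw [Node.undecided_insert_B, herase, hA, Nat.add_sub_cancel] at hleft
  rw [Node.undecided_insert_A, herase, hA', Nat.add_sub_cancel] at hright
  have hpascal := Nat.choose_succ_succ' (l + u) l
  have hpos : 0 < (l + u).choose l := Nat.choose_pos (Nat.le_add_right _ _)
  calc _ ≤ (({(ν.left L n).B} : Finset (Finset (Fin N))) \ K).card +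
        (ν.left L n).shutDownBudget L + (ν.right L n).shutDownBudget L := by
        rw [hlb]
        gcongr
    _ ≤ (l + u).choose (l + 1) + ((l + u).choose l - 1) := Nat.add_le_add hleft hright
    _ ≤ ν.shutDownBudget L := by
        rw [Node.shutDownBudget, hu, hA, Nat.add_sub_cancel]
        omega

theorem solvesAtMost_of_lbKey_eq_B {E : Method N M (Finset (Fin N)) X} (hE : E.CanSelect L)
    (hlb : E.lbKey = Node.B) (hub : E.ubKey = id) (hL : 1 ≤ L) (hLN : L ≤ N) (tol : ℝ≥0) :
    E.SolvesAtMost L tol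
      (N.choose L + ∑ i ∈ Finset.Icc 2 (N - L + 1), (N - i).choose (L - 1)) := by
  obtain ⟨hterm, hcalls⟩ := (countBound_shutDownBudget hlb hub hLN).solvesAtMost hE hLN tol
  refine ⟨hterm, fun s hs => (hcalls s hs).trans ?_⟩
  have hroot := (Node.admissible_empty N L).card_sdiff_add_shutDownBudget_le hLN
  rw [Finset.card_powersetCard, Finset.card_univ, Fintype.card_fin, Nat.choose_symm hLN, hlb,
    sum_Icc_choose_sub hL hLN]
  simpa [Node.root, Node.undecided] using hroot

theorem countBound_decisionBudget {E : Method N M (Node N) X} (hlb : E.lbKey = id)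
    (hub : E.ubKey = fun T => ⟨Tᶜ, T⟩) (hLN : L ≤ N) :
    E.CountBound L (Node.leaves N L) (Node.decisionBudget L) := by
  refine ⟨fun T hT => by rw [hub]; exact Node.mem_leaves.2 ⟨rfl, hT⟩, fun ν hv hl n hn => ?_⟩
  have hnew : (({ν.left L n, ν.right L n} : Finset (Node N)) \ insert ν (Node.leaves N L)).card ≤
      (({ν.left L n} : Finset (Node N)) \ Node.leaves N L).card +
        (({ν.right L n} : Finset (Node N)) \ Node.leaves N L).card := by
    refine (Finset.card_le_card ?_).trans (Finset.card_union_le _ _)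
    rw [← Finset.union_sdiff_distrib, ← Finset.insert_eq]
    exact Finset.sdiff_subset_sdiff (Finset.Subset.refl _) (Finset.subset_insert _ _)
  have hleft := (hv.admissible_insert_B hl hn).card_sdiff_leaves_add_decisionBudget_le hLN
  have hright := (hv.admissible_insert_A hl hn).card_sdiff_leaves_add_decisionBudget_le hLN
  obtain ⟨u, l, hlu, herase, hu, hA, hA'⟩ := hv.exists_card_undecided_eq hl hn
  rw [Node.undecided_insert_B, herase, hA] at hleft
  rw [Node.undecided_insert_A, herase, hA'] at hright
  have hpascal := Nat.choose_succ_succ' u l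
  have hpos₀ : 0 < u.choose l := Nat.choose_pos hlu.le
  have hpos₁ : 0 < u.choose (l + 1) := Nat.choose_pos hlu
  calc _ ≤ (({ν.left L n} : Finset (Node N)) \ Node.leaves N L).card +
        (ν.left L n).decisionBudget L +
        ((({ν.right L n} : Finset (Node N)) \ Node.leaves N L).card +
          (ν.right L n).decisionBudget L) := by
        simp only [hlb, id]
        omega
    _ ≤ (u.choose (l + 1) - 1) + (u.choose l - 1) := Nat.add_le_add hleft hright
    _ ≤ ν.decisionBudget L := by
        rw [Node.decisionBudget, hu, hA]
        omega

theorem solvesAtMost_of_lbKey_eq_id {E : Method N M (Node N) X} (hE : E.CanSelect L)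
    (hlb : E.lbKey = id) (hub : E.ubKey = fun T => ⟨Tᶜ, T⟩) (hLN : L ≤ N) (tol : ℝ≥0) :
    E.SolvesAtMost L tol (2 * N.choose L - 1) := by
  obtain ⟨hterm, hcalls⟩ := (countBound_decisionBudget hlb hub hLN).solvesAtMost hE hLN tol
  refine ⟨hterm, fun s hs => (hcalls s hs).trans ?_⟩
  have hroot := (Node.admissible_empty N L).card_sdiff_leaves_add_decisionBudget_le hLN
  have hleaves := Node.card_leaves_le hLN
  have hpos : 0 < N.choose L := Nat.choose_pos hLN
  simp only [Node.undecided, Finset.union_empty, Finset.compl_empty, Finset.card_univ,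
    Fintype.card_fin, Finset.card_empty, Nat.sub_zero] at hroot
  rw [hlb, id, Node.root]
  omega

end Method

/-! ### Global optimality -/

theorem relGap_self (u : ℝ≥0∞) : relGap u u = 0 := by simp [relGap]

theorem le_mul_of_relGap_le {u l : ℝ≥0∞} {tol : ℝ≥0} (h : relGap u l ≤ tol) (hlu : l ≤ u) :
    u ≤ (1 + tol) * l := by
  rw [relGap, tsub_eq_zero_of_le hlu, add_zero] at h
  rcases eq_or_ne l ⊤ with rfl | hl
  · exact le_top.trans_eq (ENNReal.mul_top (by simp)).symm
  rcases eq_or_ne l 0 with rfl | hl0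
  · rcases eq_or_ne u 0 with rfl | hu
    · exact zero_le
    · simp [ENNReal.div_zero hu] at h
  · rw [ENNReal.div_le_iff hl0 hl, tsub_le_iff_right] at h
    rwa [add_mul, one_mul, add_comm]

theorem power_nonneg (W : Beam N M) : 0 ≤ power W :=
  Finset.sum_nonneg fun _ _ => Finset.sum_nonneg fun _ _ => sq_nonneg _

theorem power_le_of_cost_le {W W' : Beam N M} {tol : ℝ≥0}
    (h : cost (some W) ≤ (1 + tol) * ENNReal.ofReal (power W')) :
    power W ≤ (1 + (tol : ℝ)) * power W' := by
  have htol : (1 + (tol : ℝ≥0∞)) = ENNReal.ofReal (1 + (tol : ℝ)) := by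
    rw [ENNReal.ofReal_add zero_le_one tol.coe_nonneg, ENNReal.ofReal_one,
      ENNReal.ofReal_coe_nnreal]
  have hnonneg : 0 ≤ 1 + (tol : ℝ) := by positivity
  rw [cost, htol, ← ENNReal.ofReal_mul hnonneg] at h
  exact (ENNReal.ofReal_le_ofReal_iff (mul_nonneg hnonneg (power_nonneg W'))).1 h

namespace Method

variable {κ X : Type} {E : Method N M κ X} {feas : Set (Beam N M)}

/-- A method whose bounds are exact at the leaves and valid elsewhere: the lower bound of a leaf
is its upper bound, upper bound solutions are feasible, and every feasible beamforming matrix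
belongs to a leaf such that it costs at least the lower bounds of all ancestors of this leaf. -/
structure IsExact (E : Method N M κ X) (L : ℕ) (feas : Set (Beam N M)) : Prop where
  ubKey_eq : ∀ ν : Node N, ν.IsLeaf L → ν.A = ν.Bᶜ → E.ubKey ν.B = E.lbKey ν
  exists_beam : ∀ T : Finset (Fin N), T.card = N - L → ∀ x, E.solve (E.ubKey T) = some x →
    ∃ W ∈ feas, E.beam x = some W ∧ power W = E.value x
  relax : ∀ W ∈ feas, ∃ T : Finset (Fin N), T.card = N - L ∧
    ∀ ν : Node N, ν.Compatible T → E.lb ν ≤ ENNReal.ofReal (power W)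

namespace IsExact

variable {ν : Node N} {o : Option (Finset (Fin N))}

theorem ubBeam_mem (h : E.IsExact L feas) (ho : E.Excludes L ν o) :
    ∀ W, E.ubBeam o = some W → W ∈ feas := by
  intro W hW
  obtain ⟨T, rfl, hT⟩ := Option.bind_eq_some_iff.1 hW
  obtain ⟨x, hx, hxW⟩ := Option.bind_eq_some_iff.1 hT
  obtain ⟨V, hV, hxV, -⟩ := h.exists_beam T ho.2.2.1 x hx
  rw [hxV, Option.some.injEq] at hxW
  rwa [← hxW]

theorem cost_ubBeam_le_lb (h : E.IsExact L feas) (hν : ν.Valid L) (hl : ν.IsLeaf L)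
    (ho : E.Excludes L ν o) : cost (E.ubBeam o) ≤ E.lb ν := by
  cases hs : E.solve (E.lbKey ν) with
  | none => simp only [lb, hs, le_top]
  | some x =>
    cases o with
    | none => exact absurd (hs.symm.trans ho) (Option.some_ne_none x)
    | some T =>
      obtain rfl : ν.B = T := Finset.eq_of_subset_of_card_le ho.1 (ho.2.2.1.trans hl.2.symm).le
      have hkey := h.ubKey_eq ν hl (hν.A_eq_compl_of_isLeaf hl)
      obtain ⟨W, -, hxW, hval⟩ := h.exists_beam ν.B hl.2 x (hkey ▸ hs)
      simp only [ubBeam, lb, hkey, hs, Option.bind_some, hxW, cost, hval, le_refl]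

end IsExact

/-- The invariant of the search. By `cover`, a leaf that is no longer below an unbranched node has
been discarded because it costs more than the incumbent. -/
structure SearchInvariant (E : Method N M κ X) (L : ℕ) (feas : Set (Beam N M))
    (s : State N M κ) : Prop where
  upper_eq : s.upper = cost s.incumbent
  incumbent_mem : ∀ W, s.incumbent = some W → W ∈ feas
  cover : ∀ T : Finset (Fin N), T.card = N - L →
    ∃ ν : Node N, ν.Compatible T ∧ (ν ∈ s.frontier ∨ s.upper < E.lb ν)
  lower_le : ∀ ν ∈ s.frontier, s.lower ≤ E.lb ν
  upper_le_of_isLeaf : ∀ ν ∈ s.frontier, ν.IsLeaf L → s.upper ≤ E.lb ν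
  exists_lb_eq : s.lower ≤ s.upper → ∃ ν ∈ s.frontier, E.lb ν = s.lower

theorem exists_compatible_next (hLN : L ≤ N) {s : State N M κ} {ν : Node N} {n : Fin N}
    {W : Option (Beam N M)} {c : Finset κ × ℕ} {T : Finset (Fin N)} (hT : T.card = N - L)
    (hcover : ∃ ν' : Node N, ν'.Compatible T ∧ (ν' ∈ s.frontier ∨ s.upper < E.lb ν')) :
    ∃ ν' : Node N, ν'.Compatible T ∧
      (ν' ∈ (E.next s ν (ν.left L n) (ν.right L n) W c).frontier ∨
        (E.next s ν (ν.left L n) (ν.right L n) W c).upper < E.lb ν') := by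
  set s' := E.next s ν (ν.left L n) (ν.right L n) W c
  have keep {ν' : Node N} (h : ν' = ν.left L n ∨ ν' = ν.right L n ∨ ν' ≠ ν ∧ ν' ∈ s.frontier) :
      ν' ∈ s'.frontier ∨ s'.upper < E.lb ν' :=
    (le_or_gt (E.lb ν') s'.upper).imp_left fun hle =>
      (E.mem_frontier_next s ν (ν.left L n) (ν.right L n) W c).2 ⟨h, hle⟩
  obtain ⟨ν', hc, hν' | hlt⟩ := hcover
  · rcases eq_or_ne ν' ν with rfl | hne
    · rcases hc.left_or_right hLN hT n with hc | hc
      · exact ⟨_, hc, keep (Or.inl rfl)⟩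
      · exact ⟨_, hc, keep (Or.inr (Or.inl rfl))⟩
    · exact ⟨ν', hc, keep (Or.inr (Or.inr ⟨hne, hν'⟩))⟩
  · refine ⟨ν', hc, Or.inr (lt_of_le_of_lt ?_ hlt)⟩
    exact (E.upper_next s ν _ _ W c).trans_le (min_le_right _ _)

variable {tol : ℝ≥0} {s s' : State N M κ}

theorem SearchInvariant.lower_le_upper (h : E.IsExact L feas) (hs : E.SearchInvariant L feas s) :
    s.lower ≤ s.upper := by
  cases hW : s.incumbent with
  | none => rw [hs.upper_eq, hW]; exact le_top
  | some W =>
    have hupper : s.upper = ENNReal.ofReal (power W) := by rw [hs.upper_eq, hW, cost]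
    obtain ⟨T, hT, hle⟩ := h.relax W (hs.incumbent_mem W hW)
    obtain ⟨ν, hc, hν | hlt⟩ := hs.cover T hT
    · exact ((hs.lower_le ν hν).trans (hle ν hc)).trans_eq hupper.symm
    · exact absurd (hle ν hc) (not_le.2 (hupper ▸ hlt))

theorem SearchInvariant.lower_le_power (h : E.IsExact L feas) (hs : E.SearchInvariant L feas s)
    {W : Beam N M} (hW : W ∈ feas) : s.lower ≤ ENNReal.ofReal (power W) := by
  obtain ⟨T, hT, hle⟩ := h.relax W hW
  obtain ⟨ν, hc, hν | hlt⟩ := hs.cover T hT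
  · exact (hs.lower_le ν hν).trans (hle ν hc)
  · exact (hs.lower_le_upper h).trans (hlt.le.trans (hle ν hc))

variable [DecidableEq κ]

namespace IsExact

theorem invariant_of_initial (h : E.IsExact L feas) (hLN : L ≤ N) (hs : E.Initial L s) :
    E.SearchInvariant L feas s := by
  obtain ⟨o, ho, rfl⟩ := hs
  refine ⟨rfl, h.ubBeam_mem ho, fun T hT => ⟨_, Node.compatible_root hLN hT,
    Or.inl (Finset.mem_singleton_self _)⟩, ?_, ?_, fun _ => ⟨_, Finset.mem_singleton_self _, rfl⟩⟩
  · rintro ν hν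
    rw [Finset.mem_singleton.1 hν]
  · rintro ν hν hl
    obtain rfl := Finset.mem_singleton.1 hν
    exact h.cost_ubBeam_le_lb (Node.valid_root hLN) hl ho

theorem invariant_of_step (h : E.IsExact L feas) (hLN : L ≤ N) (hv : ∀ ν ∈ s.frontier, ν.Valid L)
    (hs : E.SearchInvariant L feas s) (hstep : E.Step L tol s s') :
    E.SearchInvariant L feas s' := by
  obtain ⟨-, ν, hν, hl, -, x, -, n, hn, -, o₁, o₂, ho₁, ho₂, W, hW, hW₁, hW₂, rfl⟩ := hstep
  set c := E.evaluate (E.evaluate (s.cache, s.calls) (ν.left L n) o₁) (ν.right L n) o₂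
  have hupper := E.upper_next s ν (ν.left L n) (ν.right L n) W c
  have hleW := hupper.trans_le (min_le_left _ _)
  have hles := hupper.trans_le (min_le_right _ _)
  refine ⟨upper_next_eq_cost hs.upper_eq, forall_incumbent_next ?_ hs.incumbent_mem,
    fun T hT => exists_compatible_next hLN hT (hs.cover T hT), fun _ => lower_next_le,
    forall_mem_frontier_next ?_ ?_ ?_, exists_lb_eq_lower_next⟩
  · rcases hW with rfl | rfl
    · exact h.ubBeam_mem ho₁
    · exact h.ubBeam_mem ho₂
  · exact fun hl₁ => (hleW.trans hW₁).trans
      (h.cost_ubBeam_le_lb ((hv ν hν).left hLN hl hn) hl₁ ho₁)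
  · exact fun hl₂ => (hleW.trans hW₂).trans
      (h.cost_ubBeam_le_lb ((hv ν hν).right hLN hl hn) hl₂ ho₂)
  · exact fun ν' hν' hl' => hles.trans (hs.upper_le_of_isLeaf ν' hν' hl')

theorem invariant_of_reachable (h : E.IsExact L feas) (hLN : L ≤ N) (hs : E.Reachable L tol s) :
    E.SearchInvariant L feas s :=
  hs.induction (fun _ => h.invariant_of_initial hLN)
    fun _ _ hs ih hstep => h.invariant_of_step hLN (hs.valid hLN) ih hstep

theorem exists_step (h : E.IsExact L feas) (hE : E.CanSelect L) (hLN : L ≤ N)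
    (hs : E.Reachable L tol s) (hhalt : ¬ Halted tol s) : ∃ s', E.Step L tol s s' := by
  have hinv := h.invariant_of_reachable hLN hs
  have hlt : s.lower < s.upper := by
    refine (hinv.lower_le_upper h).lt_of_ne fun heq => hhalt (Or.inr ?_)
    rw [heq, relGap_self]
    exact zero_le
  obtain ⟨ν, hν, hlb⟩ := hinv.exists_lb_eq hlt.le
  have hv := hs.valid hLN ν hν
  have hl : ¬ ν.IsLeaf L := fun hl => (hinv.upper_le_of_isLeaf ν hν hl).not_gt (hlb ▸ hlt)
  obtain ⟨x, hx⟩ : ∃ x, E.solve (E.lbKey ν) = some x := by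
    refine Option.ne_none_iff_exists'.1 fun hnone => ?_
    simp only [lb, hnone] at hlb
    exact not_top_lt (hlb ▸ hlt)
  obtain ⟨n, hn, hbranch⟩ := hE.exists_branch ν x
    (Finset.card_pos.1 ((Nat.zero_le _).trans_lt (hv.lt_card_undecided hl)))
  obtain ⟨o₁, ho₁⟩ := hE.exists_excludes (hv.left hLN hl hn).toAdmissible
  obtain ⟨o₂, ho₂⟩ := hE.exists_excludes (hv.right hLN hl hn).toAdmissible
  obtain ⟨W, hW, hW₁, hW₂⟩ : ∃ W, (W = E.ubBeam o₁ ∨ W = E.ubBeam o₂) ∧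
      cost W ≤ cost (E.ubBeam o₁) ∧ cost W ≤ cost (E.ubBeam o₂) :=
    (le_total (cost (E.ubBeam o₁)) (cost (E.ubBeam o₂))).elim
      (fun hle => ⟨_, Or.inl rfl, le_rfl, hle⟩) fun hle => ⟨_, Or.inr rfl, hle, le_rfl⟩
  exact ⟨_, hhalt, ν, hν, hl, fun ν' hν' _ => hlb.le.trans (hinv.lower_le ν' hν'), x, hx, n, hn,
    hbranch, o₁, o₂, ho₁, ho₂, W, hW, hW₁, hW₂, rfl⟩

theorem upper_le_of_halted (h : E.IsExact L feas) (hLN : L ≤ N) (hs : E.Reachable L tol s)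
    (hhalt : Halted tol s) {W : Beam N M} (hW : W ∈ feas) :
    s.upper ≤ (1 + tol) * ENNReal.ofReal (power W) := by
  have hinv := h.invariant_of_reachable hLN hs
  have hle := hinv.lower_le_upper h
  refine le_trans ?_ (mul_le_mul_right (hinv.lower_le_power h hW) _)
  rcases hhalt with hempty | hgap
  · obtain ⟨ν, hν, -⟩ := hinv.exists_lb_eq hle
    simp [hempty] at hν
  · exact le_mul_of_relGap_le hgap hle

theorem solvesOptimally (h : E.IsExact L feas) (hE : E.CanSelect L) (hLN : L ≤ N) (tol : ℝ≥0) :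
    E.SolvesOptimally L tol feas := by
  refine ⟨hE.terminates hLN tol, fun s => h.exists_step hE hLN, fun s hs hhalt => ⟨?_, ?_⟩⟩
  all_goals have hinv := h.invariant_of_reachable hLN hs
  · refine fun W hW => ⟨hinv.incumbent_mem W hW, fun W' hW' => power_le_of_cost_le ?_⟩
    rw [← hW, ← hinv.upper_eq]
    exact h.upper_le_of_halted hLN hs hhalt hW'
  · refine fun hnone => Set.eq_empty_of_forall_notMem fun W' hW' => ?_
    have hle := h.upper_le_of_halted hLN hs hhalt hW'
    rw [hinv.upper_eq, hnone, cost, top_le_iff] at hle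
    exact ENNReal.mul_ne_top (by simp) ENNReal.ofReal_ne_top hle

end IsExact

end Method

/-! ### Positive semidefinite matrices -/

section PosSemidef

variable {𝕜 : Type*} [RCLike 𝕜] {ι κ : Type*}

theorem re_diag_nonneg {S : Matrix ι ι 𝕜} (hS : S.PosSemidef) (i : ι) : 0 ≤ RCLike.re (S i i) :=
  (RCLike.nonneg_iff.1 hS.diag_nonneg).1

theorem isClosed_posSemidef [Finite ι] : IsClosed {S : Matrix ι ι 𝕜 | S.PosSemidef} := by
  cases nonempty_fintype ι
  simp only [Matrix.posSemidef_iff_dotProduct_mulVec, Set.ofPred_and, Set.ofPred_forall]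
  refine (isClosed_eq continuous_id.matrix_conjTranspose continuous_id).inter
    (isClosed_iInter fun x => isClosed_le continuous_const ?_)
  fun_prop

variable [Fintype ι]

theorem star_dotProduct_self (u : ι → 𝕜) : star u ⬝ᵥ u = ((∑ i, ‖u i‖ ^ 2 : ℝ) : 𝕜) := by
  simp only [dotProduct, Pi.star_apply, RCLike.star_def, RCLike.conj_mul]
  norm_cast

theorem norm_star_dotProduct_sq_le (u v : ι → 𝕜) :
    ‖star u ⬝ᵥ v‖ ^ 2 ≤ (∑ i, ‖u i‖ ^ 2) * ∑ i, ‖v i‖ ^ 2 := by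
  calc ‖star u ⬝ᵥ v‖ ^ 2 ≤ (∑ i, ‖u i‖ * ‖v i‖) ^ 2 := by
        gcongr
        exact (norm_sum_le _ _).trans_eq (by simp only [norm_mul, Pi.star_apply, norm_star])
    _ ≤ _ := Finset.sum_mul_sq_le_sq_mul_sq _ _ _

theorem re_conjTranspose_mul_self_apply_self (B : Matrix ι κ 𝕜) (k : κ) :
    RCLike.re ((Bᴴ * B) k k) = ∑ i, ‖B i k‖ ^ 2 := by
  have h : (Bᴴ * B) k k = star (B.col k) ⬝ᵥ B.col k := rfl
  rw [h, star_dotProduct_self, RCLike.ofReal_re]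
  rfl

open scoped MatrixOrder in
theorem exists_eq_conjTranspose_mul_self {S : Matrix ι ι 𝕜} (hS : S.PosSemidef) :
    ∃ B : Matrix ι ι 𝕜, S = Bᴴ * B := by
  classical exact CStarAlgebra.nonneg_iff_eq_star_mul_self.mp hS.nonneg

theorem re_diag_le_re_trace {S : Matrix ι ι 𝕜} (hS : S.PosSemidef) (i : ι) :
    RCLike.re (S i i) ≤ RCLike.re S.trace := by
  rw [Matrix.trace, map_sum]
  exact Finset.single_le_sum (f := fun j => RCLike.re (S j j)) (fun j _ => re_diag_nonneg hS j)
    (Finset.mem_univ i)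

theorem norm_apply_le_re_trace {S : Matrix ι ι 𝕜} (hS : S.PosSemidef) (i j : ι) :
    ‖S i j‖ ≤ RCLike.re S.trace := by
  have hi := re_diag_le_re_trace hS i
  have hj := re_diag_le_re_trace hS j
  obtain ⟨B, rfl⟩ := exists_eq_conjTranspose_mul_self hS
  rw [re_conjTranspose_mul_self_apply_self] at hi hj
  have hij : ‖(Bᴴ * B) i j‖ ≤ ∑ k, (‖B k i‖ ^ 2 + ‖B k j‖ ^ 2) / 2 := by
    rw [Matrix.mul_apply]
    refine (norm_sum_le _ _).trans (Finset.sum_le_sum fun k _ => ?_)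
    rw [norm_mul, Matrix.conjTranspose_apply, norm_star]
    linarith [two_mul_le_add_sq ‖B k i‖ ‖B k j‖]
  rw [← Finset.sum_div, Finset.sum_add_distrib] at hij
  linarith

theorem re_dotProduct_mulVec_le {S : Matrix ι ι 𝕜} (hS : S.PosSemidef) (h : ι → 𝕜) :
    RCLike.re (star h ⬝ᵥ (S *ᵥ h)) ≤ RCLike.re S.trace * ∑ i, ‖h i‖ ^ 2 := by
  obtain ⟨B, rfl⟩ := exists_eq_conjTranspose_mul_self hS
  have hquad : star h ⬝ᵥ ((Bᴴ * B) *ᵥ h) = star (B *ᵥ h) ⬝ᵥ (B *ᵥ h) := by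
    rw [← Matrix.mulVec_mulVec, Matrix.dotProduct_mulVec, Matrix.star_mulVec]
  rw [hquad, star_dotProduct_self, RCLike.ofReal_re, Matrix.trace, map_sum]
  simp only [Matrix.diag_apply, re_conjTranspose_mul_self_apply_self]
  rw [Finset.sum_comm, Finset.sum_mul]
  refine Finset.sum_le_sum fun k _ => ?_
  have hrow := norm_star_dotProduct_sq_le (star (B.row k)) h
  simp only [star_star, Pi.star_apply, norm_star] at hrow
  exact hrow

theorem posSemidef_one_sub_vecMulVec [DecidableEq ι] {u : ι → 𝕜} (hu : ∑ i, ‖u i‖ ^ 2 ≤ 1) :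
    (1 - Matrix.vecMulVec u (star u)).PosSemidef := by
  refine .of_dotProduct_mulVec_nonneg (Matrix.isHermitian_one.sub
    (Matrix.posSemidef_vecMulVec_self_star u).isHermitian) fun x => ?_
  have hux : star x ⬝ᵥ u = star (star u ⬝ᵥ x) := by rw [← Matrix.star_dotProduct_star, star_star]
  rw [Matrix.sub_mulVec, Matrix.one_mulVec, Matrix.vecMulVec_mulVec, op_smul_eq_smul,
    dotProduct_sub, dotProduct_smul, star_dotProduct_self, hux, smul_eq_mul, RCLike.star_def,
    RCLike.mul_conj, ← RCLike.ofReal_pow, ← RCLike.ofReal_sub, RCLike.ofReal_nonneg, sub_nonneg]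
  exact (norm_star_dotProduct_sq_le u x).trans (mul_le_of_le_one_left (by positivity) hu)

theorem exists_dotProduct_smul_eq_self (b : ι → 𝕜) :
    ∃ u : ι → 𝕜, ∑ i, ‖u i‖ ^ 2 ≤ 1 ∧ (star u ⬝ᵥ b) • u = b := by
  set c : ℝ := ∑ i, ‖b i‖ ^ 2 with hc
  have hsq : (√c)⁻¹ * (√c)⁻¹ = c⁻¹ := by rw [← mul_inv, Real.mul_self_sqrt (by positivity)]
  refine ⟨((√c)⁻¹ : ℝ) • b, ?_, ?_⟩
  · simp only [Pi.smul_apply, norm_smul, mul_pow, ← Finset.mul_sum, norm_inv,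
      Real.norm_of_nonneg (Real.sqrt_nonneg c), ← hc]
    rw [sq, hsq]
    exact inv_mul_le_one
  · rcases eq_or_ne b 0 with rfl | hb
    · simp
    have hc0 : c ≠ 0 := fun h0 => hb <| by
      rw [← dotProduct_star_self_eq_zero, star_dotProduct_self, ← hc, h0, RCLike.ofReal_zero]
    rw [star_smul, smul_dotProduct, star_dotProduct_self, star_trivial, ← hc,
      RCLike.real_smul_ofReal, ← RCLike.ofReal_mul, ← RCLike.real_smul_eq_coe_smul, smul_smul,
      mul_right_comm, hsq, inv_mul_cancel₀ hc0, one_smul]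

theorem exists_eq_vecMulVec_add {S : Matrix ι ι 𝕜} (hS : S.PosSemidef) (q : ι → 𝕜) :
    ∃ (a : ι → 𝕜) (D : Matrix ι ι 𝕜), D.PosSemidef ∧ D *ᵥ q = 0 ∧
      S = Matrix.vecMulVec a (star a) + D := by
  classical
  obtain ⟨B, rfl⟩ := exists_eq_conjTranspose_mul_self hS
  obtain ⟨u, hu, hub⟩ := exists_dotProduct_smul_eq_self (B *ᵥ q)
  refine ⟨Bᴴ *ᵥ u, Bᴴ * (1 - Matrix.vecMulVec u (star u)) * B,
    (posSemidef_one_sub_vecMulVec hu).conjTranspose_mul_mul_same B, ?_, ?_⟩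
  · rw [← Matrix.mulVec_mulVec, ← Matrix.mulVec_mulVec, Matrix.sub_mulVec, Matrix.one_mulVec,
      Matrix.vecMulVec_mulVec, op_smul_eq_smul, hub, sub_self, Matrix.mulVec_zero]
  · rw [Matrix.star_mulVec, Matrix.conjTranspose_conjTranspose, ← Matrix.vecMulVec_mul,
      ← Matrix.mul_vecMulVec, Matrix.mul_sub, Matrix.mul_one, Matrix.sub_mul, add_sub_cancel]

end PosSemidef

section QuadraticForm

variable {S : Matrix (Fin N) (Fin N) ℂ}

theorem quad_add (S S' : Matrix (Fin N) (Fin N) ℂ) (h : Fin N → ℂ) :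
    quad (S + S') h = quad S h + quad S' h := by
  simp only [quad, Matrix.add_mulVec, dotProduct_add, Complex.add_re]

theorem quad_smul (c : ℝ) (S : Matrix (Fin N) (Fin N) ℂ) (h : Fin N → ℂ) :
    quad (c • S) h = c * quad S h := by
  simp only [quad, Matrix.smul_mulVec, dotProduct_smul, Complex.smul_re, smul_eq_mul]

theorem quad_nonneg (hS : S.PosSemidef) (h : Fin N → ℂ) : 0 ≤ quad S h :=
  hS.re_dotProduct_nonneg h

theorem quad_le_trace_mul (hS : S.PosSemidef) (h : Fin N → ℂ) :
    quad S h ≤ S.trace.re * ∑ i, ‖h i‖ ^ 2 := re_dotProduct_mulVec_le hS h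

theorem quad_vecMulVec (a h : Fin N → ℂ) :
    quad (Matrix.vecMulVec a (star a)) h = ‖star a ⬝ᵥ h‖ ^ 2 := by
  have hha : star h ⬝ᵥ a = star (star a ⬝ᵥ h) := by rw [← Matrix.star_dotProduct_star, star_star]
  rw [quad, Matrix.vecMulVec_mulVec, op_smul_eq_smul, dotProduct_smul, smul_eq_mul, hha,
    RCLike.star_def, Complex.mul_conj', ← Complex.ofReal_pow, Complex.ofReal_re]

theorem re_trace_vecMulVec (a : Fin N → ℂ) :
    (Matrix.vecMulVec a (star a)).trace.re = ∑ i, ‖a i‖ ^ 2 := by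
  rw [Matrix.trace_vecMulVec, dotProduct_comm, star_dotProduct_self]
  exact Complex.ofReal_re _

theorem quad_add_of_mulVec_eq_zero (hS : S.IsHermitian) {q : Fin N → ℂ} (hq : S *ᵥ q = 0)
    (h : Fin N → ℂ) : quad S (q + h) = quad S h := by
  have hqS : star q ᵥ* S = 0 := by rw [← hS.eq, ← Matrix.star_mulVec, hq, star_zero]
  rw [quad, quad, Matrix.mulVec_add, hq, zero_add, star_add, add_dotProduct,
    Matrix.dotProduct_mulVec (star q), hqS, zero_dotProduct, zero_add]

end QuadraticForm

/-! ### Existence of solvers -/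

theorem exists_isSolver {κ X : Type} [TopologicalSpace X] (p : κ → Program X)
    (hclosed : ∀ k, IsClosed (p k).feasible) (hcont : ∀ k, Continuous (p k).objective)
    (hcompact : ∀ k r, ∃ K, IsCompact K ∧ ∀ x ∈ (p k).feasible, (p k).objective x ≤ r → x ∈ K) :
    ∃ solve, IsSolver p solve := by
  classical
  have hmin : ∀ k, (p k).feasible.Nonempty →
      ∃ x ∈ (p k).feasible, IsMinOn (p k).objective (p k).feasible x := by
    rintro k ⟨x₀, hx₀⟩
    obtain ⟨K, hK, hsub⟩ := hcompact k ((p k).objective x₀)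
    refine (hcont k).continuousOn.exists_isMinOn' (hclosed k) hx₀ ?_
    filter_upwards [Filter.mem_inf_of_left hK.compl_mem_cocompact,
      Filter.mem_inf_of_right (Filter.mem_principal_self _)] with x hxK hx
    exact le_of_not_ge fun hle => hxK (hsub x hx hle)
  choose x hx using hmin
  refine ⟨fun k => if hk : (p k).feasible.Nonempty then some (x k hk) else none,
    fun k => ⟨fun y hy => ?_, fun hk => ?_⟩⟩
  · obtain ⟨hk, hy⟩ := Option.dite_none_right_eq_some.1 hy
    obtain rfl := Option.some.inj hy
    exact ⟨(hx k hk).1, isMinOn_iff.1 (hx k hk).2⟩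
  · by_contra hne
    simp [Set.nonempty_iff_ne_empty.2 hne] at hk

theorem isCompact_setOf_norm_apply_le {ι κ : Type*} (r : ℝ) :
    IsCompact {W : Matrix ι κ ℂ | ∀ i j, ‖W i j‖ ≤ r} := by
  have hrow : IsCompact {w : κ → ℂ | ∀ j, ‖w j‖ ≤ r} := by
    simpa only [mem_closedBall_zero_iff] using
      isCompact_pi_infinite fun _ : κ => isCompact_closedBall (0 : ℂ) r
  exact isCompact_pi_infinite fun _ : ι => hrow

theorem isCompact_lifted_setOf_norm_apply_le (r : ℝ) :
    IsCompact {S : Lifted N M | ∀ m i j, ‖S m i j‖ ≤ r} :=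
  isCompact_pi_infinite fun _ => isCompact_setOf_norm_apply_le r

theorem continuous_power : Continuous (power : Beam N M → ℝ) := by
  unfold power; fun_prop

theorem continuous_rowPower (n : Fin N) : Continuous fun W : Beam N M => rowPower W n := by
  unfold rowPower; fun_prop

theorem continuous_gain (j : Fin M) (h : Fin N → ℂ) :
    Continuous fun W : Beam N M => gain W j h := by
  simp only [gain, dotProduct, Pi.star_apply, Matrix.col_apply]; fun_prop

theorem continuous_quad (h : Fin N → ℂ) : Continuous fun S => quad S h := by
  unfold quad; fun_prop

theorem continuous_liftedPower : Continuous (liftedPower : Lifted N M → ℝ) := by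
  unfold liftedPower; fun_prop

theorem continuous_liftedRowPower (n : Fin N) :
    Continuous fun S : Lifted N M => liftedRowPower S n := by
  unfold liftedRowPower; fun_prop

theorem isClosed_setOf_row_eq_zero {ι κ : Type*} (B : Finset ι) :
    IsClosed {W : Matrix ι κ ℂ | ∀ n ∈ B, W.row n = 0} := by
  simp only [Set.ofPred_forall]
  exact isClosed_biInter fun n _ => isClosed_eq
    (continuous_pi fun j => continuous_id.matrix_elem n j) continuous_const

theorem isClosed_socConstraint (P : Instance N M) :
    IsClosed {W : Beam N M | socConstraint P W} := by
  have hgain (j m : Fin M) := continuous_gain (N := N) j (P.H.col m)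
  simp only [socConstraint, Set.ofPred_forall]
  exact isClosed_iInter fun m => isClosed_le (by fun_prop) (by fun_prop)

theorem interference_pos {P : Instance N M} (hσ : ∀ m, 0 < P.σ m) {q : Fin M → ℝ}
    (hq : ∀ l, 0 ≤ q l) (m : Fin M) : 0 < ∑ l ∈ Finset.univ.erase m, q l + P.σ m ^ 2 :=
  add_pos_of_nonneg_of_pos (Finset.sum_nonneg fun l _ => hq l) (pow_pos (hσ m) 2)

theorem sdrConstraint_iff {P : Instance N M} (hσ : ∀ m, 0 < P.σ m) (S : Lifted N M) :
    sdrConstraint P S ↔ (∀ m, (S m).PosSemidef) ∧ ∀ m, ∀ h ∈ channelBall P m,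
      P.γ m * (∑ l ∈ Finset.univ.erase m, quad (S l) h + P.σ m ^ 2) ≤ quad (S m) h :=
  and_congr_right fun hS => forall_congr' fun m => forall₂_congr fun h _ =>
    le_div_iff₀ (interference_pos hσ (fun l => quad_nonneg (hS l) h) m)

theorem isClosed_sdrConstraint {P : Instance N M} (hσ : ∀ m, 0 < P.σ m) :
    IsClosed {S : Lifted N M | sdrConstraint P S} := by
  have hquad (m : Fin M) (h : Fin N → ℂ) : Continuous fun S : Lifted N M => quad (S m) h :=
    (continuous_quad h).comp (continuous_apply m)
  simp only [sdrConstraint_iff hσ, Set.ofPred_and, Set.ofPred_forall]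
  exact (isClosed_iInter fun m => isClosed_posSemidef.preimage (continuous_apply m)).inter
    (isClosed_iInter fun m => isClosed_biInter fun h _ => isClosed_le
      (continuous_const.mul ((continuous_finsetSum _ fun l _ => hquad l h).add continuous_const))
      (hquad m h))

theorem isClosed_boolRelaxed (ν : Node N) : IsClosed {z : Fin N → ℝ | boolRelaxed L ν z} := by
  simp only [boolRelaxed, Set.ofPred_and, Set.ofPred_forall]
  refine .inter (isClosed_iInter fun n => ?_) (.inter (isClosed_le (by fun_prop) (by fun_prop))
    (.inter (isClosed_biInter fun n _ => ?_) (isClosed_biInter fun n _ => ?_)))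
  · exact (isClosed_le (by fun_prop) (by fun_prop)).inter (isClosed_le (by fun_prop) (by fun_prop))
  all_goals exact isClosed_eq (by fun_prop) (by fun_prop)

theorem mem_Icc_of_boolRelaxed {ν : Node N} {z : Fin N → ℝ} (h : boolRelaxed L ν z) :
    z ∈ Set.Icc (0 : Fin N → ℝ) 1 := ⟨fun n => (h.1 n).1, fun n => (h.1 n).2⟩

theorem norm_apply_le_sqrt_power (W : Beam N M) (n : Fin N) (m : Fin M) :
    ‖W n m‖ ≤ √(power W) := by
  refine Real.le_sqrt_of_sq_le ?_
  calc ‖W n m‖ ^ 2 ≤ ∑ m, ‖W n m‖ ^ 2 :=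
        Finset.single_le_sum (f := fun m => ‖W n m‖ ^ 2) (fun _ _ => by positivity)
          (Finset.mem_univ m)
    _ ≤ power W :=
        Finset.single_le_sum (f := fun n => ∑ m, ‖W n m‖ ^ 2) (fun _ _ => by positivity)
          (Finset.mem_univ n)

theorem norm_apply_le_liftedPower {S : Lifted N M} (hS : ∀ m, (S m).PosSemidef) (m : Fin M)
    (i j : Fin N) : ‖S m i j‖ ≤ liftedPower S :=
  (norm_apply_le_re_trace (hS m) i j).trans <|
    Finset.single_le_sum (f := fun m => (S m).trace.re)
      (fun l _ => (Complex.nonneg_iff.1 (hS l).trace_nonneg).1) (Finset.mem_univ m)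

theorem exists_isSolver_socp (P : Instance N M) : ∃ solve, IsSolver (socp P) solve :=
  exists_isSolver _
    (fun B => (isClosed_socConstraint P).inter (isClosed_setOf_row_eq_zero B))
    (fun _ => continuous_power)
    fun _ r => ⟨_, isCompact_setOf_norm_apply_le (√r), fun W _ hr n m =>
      (norm_apply_le_sqrt_power W n m).trans (Real.sqrt_le_sqrt hr)⟩

theorem exists_isSolver_sdr {P : Instance N M} (hσ : ∀ m, 0 < P.σ m) :
    ∃ solve, IsSolver (sdr P) solve := by
  have hrows (B : Finset (Fin N)) : IsClosed {S : Lifted N M | ∀ m, ∀ n ∈ B, (S m).row n = 0} := by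
    rw [Set.ofPred_forall]
    exact isClosed_iInter fun m => (isClosed_setOf_row_eq_zero B).preimage
      (f := fun S : Lifted N M => S m) (continuous_apply m)
  exact exists_isSolver _ (fun B => (isClosed_sdrConstraint hσ).inter (hrows B))
    (fun _ => continuous_liftedPower)
    fun _ r => ⟨_, isCompact_lifted_setOf_norm_apply_le r, fun S hS hr m i j =>
      (norm_apply_le_liftedPower hS.1.1 m i j).trans hr⟩

theorem exists_isSolver_bigMSocp (P : Instance N M) (C : ℝ) :
    ∃ solve, IsSolver (bigMSocp P L C) solve := by
  have hpower : IsClosed {Y : Beam N M × (Fin N → ℝ) | ∀ n, √(rowPower Y.1 n) ≤ C * Y.2 n} := by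
    rw [Set.ofPred_forall]
    exact isClosed_iInter fun n =>
      isClosed_le ((continuous_rowPower n).comp continuous_fst).sqrt (by fun_prop)
  exact exists_isSolver _ (fun ν => ((isClosed_socConstraint P).preimage continuous_fst).inter
      (((isClosed_boolRelaxed ν).preimage continuous_snd).inter hpower))
    (fun _ => continuous_power.comp continuous_fst)
    fun _ r => ⟨_, (isCompact_setOf_norm_apply_le (√r)).prod isCompact_Icc, fun Y hY hr =>
      ⟨fun n m => (norm_apply_le_sqrt_power Y.1 n m).trans (Real.sqrt_le_sqrt hr),
        mem_Icc_of_boolRelaxed hY.2.1⟩⟩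

theorem exists_isSolver_bigMSdr {P : Instance N M} (hσ : ∀ m, 0 < P.σ m) (C : ℝ) :
    ∃ solve, IsSolver (bigMSdr P L C) solve := by
  have hpower : IsClosed {Y : Lifted N M × (Fin N → ℝ) |
      ∀ n, liftedRowPower Y.1 n ≤ C ^ 2 * Y.2 n} := by
    rw [Set.ofPred_forall]
    exact isClosed_iInter fun n =>
      isClosed_le ((continuous_liftedRowPower n).comp continuous_fst) (by fun_prop)
  exact exists_isSolver _ (fun ν => ((isClosed_sdrConstraint hσ).preimage continuous_fst).inter
      (((isClosed_boolRelaxed ν).preimage continuous_snd).inter hpower))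
    (fun _ => continuous_liftedPower.comp continuous_fst)
    fun _ r => ⟨_, (isCompact_lifted_setOf_norm_apply_le r).prod isCompact_Icc, fun Y hY hr =>
      ⟨fun m i j => (norm_apply_le_liftedPower hY.1.1 m i j).trans hr,
        mem_Icc_of_boolRelaxed hY.2.1⟩⟩

/-! ### Perfect CSI -/

theorem Method.lb_le_of_mem_feasible {κ X : Type} {E : Method N M κ X} {p : κ → Program X}
    (h : IsSolver p E.solve) {ν : Node N} (hv : (p (E.lbKey ν)).objective = E.value) {y : X}
    (hy : y ∈ (p (E.lbKey ν)).feasible) : E.lb ν ≤ ENNReal.ofReal (E.value y) := by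
  unfold lb
  split
  case h_1 x hx =>
    rw [← hv]
    exact ENNReal.ofReal_le_ofReal (((h _).1 x hx).2 y hy)
  case h_2 hnone =>
    rw [(h _).2 hnone] at hy
    exact absurd hy (Set.notMem_empty y)

theorem rowZero_le_iff (hLN : L ≤ N) {W : Beam N M} :
    rowZero W ≤ L ↔ ∃ T : Finset (Fin N), T.card = N - L ∧ ∀ n ∈ T, W.row n = 0 := by
  classical
  set Z : Finset (Fin N) := {n | W.row n = 0} with hZ
  have hcard : rowZero W + Z.card = N := by
    have hrow : rowZero W = Zᶜ.card := by
      rw [rowZero, ← Set.ncard_coe_finset]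
      congr 1
      ext n
      simp [hZ]
    rw [hrow, add_comm, Finset.card_add_card_compl, Fintype.card_fin]
  constructor
  · intro hW
    obtain ⟨T, hTZ, hT⟩ := Finset.exists_subset_card_eq (s := Z) (n := N - L) (by omega)
    exact ⟨T, hT, fun n hn => (Finset.mem_filter.1 (hTZ hn)).2⟩
  · rintro ⟨T, hT, hrows⟩
    have hTZ : T.card ≤ Z.card :=
      Finset.card_le_card fun n hn => Finset.mem_filter.2 ⟨Finset.mem_univ n, hrows n hn⟩
    omega

theorem le_sinr_iff {P : Instance N M} (hσ : ∀ m, 0 < P.σ m) {W : Beam N M} {m : Fin M}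
    {h : Fin N → ℂ} {c : ℝ} :
    c ≤ sinr P W m h ↔
      c * (∑ l ∈ Finset.univ.erase m, ‖gain W l h‖ ^ 2 + P.σ m ^ 2) ≤ ‖gain W m h‖ ^ 2 :=
  le_div_iff₀ (interference_pos hσ (fun _ => sq_nonneg _) m)

theorem socConstraint_iff {P : Instance N M} (hγ : ∀ m, 0 < P.γ m) {W : Beam N M} :
    socConstraint P W ↔ ∀ m, √(P.γ m * (∑ l ∈ Finset.univ.erase m, ‖gain W l (P.H.col m)‖ ^ 2 +
      P.σ m ^ 2)) ≤ (gain W m (P.H.col m)).re := by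
  refine forall_congr' fun m => ?_
  rw [one_div_mul_eq_div, le_div_iff₀' (Real.sqrt_pos.2 (hγ m)), Real.sqrt_mul (hγ m).le]

theorem le_sinr_of_socConstraint {P : Instance N M} (hσ : ∀ m, 0 < P.σ m) (hγ : ∀ m, 0 < P.γ m)
    {W : Beam N M} (h : socConstraint P W) (m : Fin M) : P.γ m ≤ sinr P W m (P.H.col m) :=
  (le_sinr_iff hσ).2 <| (Real.sqrt_le_left (norm_nonneg _)).1 <|
    ((socConstraint_iff hγ).1 h m).trans (Complex.re_le_norm _)

theorem gain_mul_diagonal (W : Beam N M) (c : Fin M → ℂ) (j : Fin M) (h : Fin N → ℂ) :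
    gain (W * Matrix.diagonal c) j h = star (c j) * gain W j h := by
  have hcol : (W * Matrix.diagonal c).col j = c j • W.col j := by
    ext n
    simp [mul_comm]
  rw [gain, hcol, star_smul, smul_dotProduct, smul_eq_mul, gain]

-- Rotating the phase of each beamformer makes its gain real without changing any modulus.
theorem exists_socConstraint {P : Instance N M} (hσ : ∀ m, 0 < P.σ m) (hγ : ∀ m, 0 < P.γ m)
    {W : Beam N M} (h : ∀ m, P.γ m ≤ sinr P W m (P.H.col m)) :
    ∃ W' : Beam N M, socConstraint P W' ∧ power W' = power W ∧
      ∀ n, W.row n = 0 → W'.row n = 0 := by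
  choose c hc hgain using fun m => Complex.exists_norm_eq_mul_self (gain W m (P.H.col m))
  refine ⟨W * Matrix.diagonal (star c), (socConstraint_iff hγ).2 fun m => ?_, ?_, fun n hn => ?_⟩
  · simp only [gain_mul_diagonal, Pi.star_apply, star_star, norm_mul, hc, one_mul]
    rw [← hgain m, Complex.ofReal_re]
    exact Real.sqrt_le_iff.2 ⟨norm_nonneg _, (le_sinr_iff hσ).1 (h m)⟩
  · simp [power, hc]
  · ext m
    have hnm : W n m = 0 := congrFun hn m
    simp [hnm]

theorem isExact_socpBB {P : Instance N M} (hLN : L ≤ N) (hσ : ∀ m, 0 < P.σ m)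
    (hγ : ∀ m, 0 < P.γ m) {solve : Finset (Fin N) → Option (Beam N M)}
    (h : IsSolver (socp P) solve) : (socpBB solve).IsExact L (bfas P L) where
  ubKey_eq _ _ _ := rfl
  exists_beam T hT W hW := by
    obtain ⟨⟨hsoc, hrows⟩, -⟩ := (h T).1 W hW
    exact ⟨W, ⟨le_sinr_of_socConstraint hσ hγ hsoc, (rowZero_le_iff hLN).2 ⟨T, hT, hrows⟩⟩,
      rfl, rfl⟩
  relax W hW := by
    obtain ⟨T, hT, hrows⟩ := (rowZero_le_iff hLN).1 hW.2
    obtain ⟨W', hsoc, hpower, hrow⟩ := exists_socConstraint hσ hγ hW.1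
    refine ⟨T, hT, fun ν hν => hpower ▸
      Method.lb_le_of_mem_feasible (E := socpBB solve) h rfl ⟨hsoc, ?_⟩⟩
    exact fun n hn => hrow n (hrows n (hν.1 hn))

/-! ### Zero-forcing directions -/

section ComplProj

variable {ι κ : Type} [Fintype ι] [DecidableEq ι] [Fintype κ] [DecidableEq κ] {G : Matrix ι κ ℂ}

theorem conjTranspose_mul_complProj (hG : IsUnit (Gᴴ * G).det) : Gᴴ * complProj G = 0 := by
  rw [complProj, Matrix.mul_sub, Matrix.mul_one, ← Matrix.mul_assoc, ← Matrix.mul_assoc,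
    Matrix.mul_nonsing_inv _ hG, Matrix.one_mul, sub_self]

theorem star_complProj_mulVec_vecMul (hG : IsUnit (Gᴴ * G).det) (h : ι → ℂ) :
    star (complProj G *ᵥ h) ᵥ* G = 0 := by
  rw [← star_eq_zero, Matrix.star_vecMul, star_star, Matrix.mulVec_mulVec,
    conjTranspose_mul_complProj hG, Matrix.zero_mulVec]

theorem star_complProj_mulVec_dotProduct (hG : IsUnit (Gᴴ * G).det) (h : ι → ℂ) :
    star (complProj G *ᵥ h) ⬝ᵥ h = ((∑ i, ‖(complProj G *ᵥ h) i‖ ^ 2 : ℝ) : ℂ) := by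
  have hsplit : h = complProj G *ᵥ h + G *ᵥ (((Gᴴ * G)⁻¹ * Gᴴ) *ᵥ h) := by
    rw [Matrix.mulVec_mulVec, ← Matrix.add_mulVec, complProj, ← Matrix.mul_assoc,
      sub_add_cancel, Matrix.one_mulVec]
  conv_lhs => arg 2; rw [hsplit]
  rw [dotProduct_add, Matrix.dotProduct_mulVec _ G, star_complProj_mulVec_vecMul hG,
    zero_dotProduct, add_zero]
  exact star_dotProduct_self _

end ComplProj

/-- `v` is a zero-forcing direction of gain `R` for user `m` when the antennas in `T` are shut
down: a unit vector that is orthogonal to the channels of all other users. -/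
structure IsZeroForcing (P : Instance N M) (T : Finset (Fin N)) (m : Fin M) (v : Fin N → ℂ)
    (R : ℝ) : Prop where
  sum_norm_sq : ∑ i, ‖v i‖ ^ 2 = 1
  apply_eq_zero : ∀ n ∈ T, v n = 0
  dotProduct_col_of_ne : ∀ l, l ≠ m → star v ⬝ᵥ P.H.col l = 0
  dotProduct_col : star v ⬝ᵥ P.H.col m = R
  gain_pos : 0 < R

variable {P : Instance N M} {T : Finset (Fin N)} {m : Fin M}

theorem isZeroForcing_extend {w : (Tᶜ : Finset (Fin N)) → ℂ} {c : ℝ} (hc : 0 < c)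
    (hw : ∑ n, ‖w n‖ ^ 2 = c) (hne : ∀ l, l ≠ m → star w ⬝ᵥ (fun n => P.H n l) = 0)
    (hm : star w ⬝ᵥ (fun n => P.H n m) = c) :
    IsZeroForcing P T m (Function.extend Subtype.val ((√c)⁻¹ • w) 0) (√c) := by
  set v : Fin N → ℂ := Function.extend Subtype.val ((√c)⁻¹ • w) 0
  have hvw (n : (Tᶜ : Finset (Fin N))) : v n = (√c)⁻¹ • w n :=
    Subtype.val_injective.extend_apply _ _ n
  have hv0 (n : Fin N) (hn : n ∉ Set.range ((↑) : (Tᶜ : Finset (Fin N)) → Fin N)) : v n = 0 :=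
    Function.extend_apply' _ _ _ hn
  have hdot (l : Fin M) :
      star v ⬝ᵥ P.H.col l = (√c)⁻¹ • (star w ⬝ᵥ fun n : (Tᶜ : Finset (Fin N)) => P.H n l) := by
    rw [← smul_dotProduct]
    refine (Fintype.sum_of_injective Subtype.val Subtype.val_injective _ _ (fun n hn => ?_)
      fun n => ?_).symm
    · simp [hv0 n hn]
    · simp [hvw]
  refine ⟨?_, fun n hn => hv0 n (by simpa using hn), fun l hl => ?_, ?_, Real.sqrt_pos.2 hc⟩
  · rw [← Fintype.sum_of_injective Subtype.val Subtype.val_injective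
      (fun n => (√c)⁻¹ ^ 2 * ‖w n‖ ^ 2) _ (fun n hn => by simp [hv0 n hn])
      fun n => by simp [hvw, mul_pow]]
    rw [← Finset.mul_sum, hw, inv_pow, Real.sq_sqrt hc.le, inv_mul_cancel₀ hc.ne']
  · rw [hdot, hne l hl, smul_zero]
  · rw [hdot, hm, Complex.real_smul, ← Complex.ofReal_mul, inv_mul_eq_div, Real.div_sqrt]

theorem exists_isZeroForcing (hε : ∀ m, 0 < P.ε m) (hγ : ∀ m, 0 < P.γ m)
    (hcond : sdrCondition P L) (hT : L ≤ Tᶜ.card) (m : Fin M) :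
    ∃ v R, IsZeroForcing P T m v R ∧ (1 + M + (M - 1 / M) * P.γ m) * P.ε m ^ 2 < R ^ 2 := by
  obtain ⟨hG, hlt⟩ := hcond Tᶜ hT m
  rw [EuclideanSpace.norm_sq_eq, lt_div_iff₀ (pow_pos (hε m) 2)] at hlt
  have hM : (1 : ℝ) ≤ M := by exact_mod_cast m.pos
  have hnonneg : 0 ≤ (1 + M + (M - 1 / M) * P.γ m) * P.ε m ^ 2 := by
    have hinv : 1 / (M : ℝ) ≤ 1 := (div_le_one (by linarith)).2 hM
    have hmul : 0 ≤ ((M : ℝ) - 1 / M) * P.γ m := mul_nonneg (by linarith) (hγ m).le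
    positivity
  have hc := hnonneg.trans_lt hlt
  refine ⟨_, _, isZeroForcing_extend hc rfl (fun l hl => ?_)
    (star_complProj_mulVec_dotProduct hG _), ?_⟩
  · exact congrFun (star_complProj_mulVec_vecMul hG _) ⟨l, hl⟩
  · exact hlt.trans_eq (Real.sq_sqrt hc.le).symm

theorem sum_norm_sq_sub_le_of_mem_channelBall {j : Fin M} {h : Fin N → ℂ}
    (hh : h ∈ channelBall P j) : ∑ i, ‖(h - P.H.col j) i‖ ^ 2 ≤ P.ε j ^ 2 := by
  have hnorm := pow_le_pow_left₀ (norm_nonneg _) hh 2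
  rwa [EuclideanSpace.norm_sq_eq] at hnorm

namespace IsZeroForcing

variable {v : Fin N → ℂ} {R : ℝ} {j : Fin M} {h : Fin N → ℂ}

theorem norm_dotProduct_sub_sq_le (hv : IsZeroForcing P T m v R) (hh : h ∈ channelBall P j) :
    ‖star v ⬝ᵥ (h - P.H.col j)‖ ^ 2 ≤ P.ε j ^ 2 := by
  have hcs := norm_star_dotProduct_sq_le v (h - P.H.col j)
  rw [hv.sum_norm_sq, one_mul] at hcs
  exact hcs.trans (sum_norm_sq_sub_le_of_mem_channelBall hh)

theorem norm_dotProduct_sq_le_of_ne (hv : IsZeroForcing P T m v R) (hj : j ≠ m)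
    (hh : h ∈ channelBall P j) : ‖star v ⬝ᵥ h‖ ^ 2 ≤ P.ε j ^ 2 := by
  have hle := hv.norm_dotProduct_sub_sq_le hh
  rwa [dotProduct_sub, hv.dotProduct_col_of_ne j hj, sub_zero] at hle

theorem abs_re_dotProduct_sub_le (hv : IsZeroForcing P T m v R) (hε : 0 ≤ P.ε j)
    (hh : h ∈ channelBall P j) : |(star v ⬝ᵥ (h - P.H.col j)).re| ≤ P.ε j :=
  (Complex.abs_re_le_norm _).trans
    ((pow_le_pow_iff_left₀ (norm_nonneg _) hε two_ne_zero).1 (hv.norm_dotProduct_sub_sq_le hh))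

theorem sq_le_norm_dotProduct_sq (hv : IsZeroForcing P T m v R) (h : Fin N → ℂ) :
    (R + (star v ⬝ᵥ (h - P.H.col m)).re) ^ 2 ≤ ‖star v ⬝ᵥ h‖ ^ 2 := by
  have hre : R + (star v ⬝ᵥ (h - P.H.col m)).re = (star v ⬝ᵥ h).re := by
    rw [dotProduct_sub, hv.dotProduct_col, Complex.sub_re, Complex.ofReal_re, add_sub_cancel]
  rw [hre]
  exact sq_le_sq.2 ((Complex.abs_re_le_norm _).trans_eq (abs_norm _).symm)

theorem sum_norm_dotProduct_sq_le {v : Fin M → Fin N → ℂ} {R : Fin M → ℝ}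
    (hv : ∀ l, IsZeroForcing P T l (v l) (R l)) (hh : h ∈ channelBall P j) :
    ∑ l ∈ Finset.univ.erase j, ‖star (v l) ⬝ᵥ h‖ ^ 2 ≤ (M - 1) * P.ε j ^ 2 := by
  refine (Finset.sum_le_card_nsmul _ _ _ fun l hl =>
    (hv l).norm_dotProduct_sq_le_of_ne (Finset.ne_of_mem_erase hl).symm hh).trans_eq ?_
  rw [Finset.card_erase_of_mem (Finset.mem_univ j), Finset.card_univ, Fintype.card_fin,
    nsmul_eq_mul, Nat.cast_sub j.pos, Nat.cast_one]

end IsZeroForcing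

/-! ### Tightness of the semidefinite relaxation -/

section Perturbation

variable {μ γ ε R : ℝ}

theorem le_and_mul_sq_le_sub_sq (hμ : 1 ≤ μ) (hγ : 0 ≤ γ) (hε : 0 ≤ ε) (hR : 0 ≤ R)
    (h : (1 + μ + (μ - 1 / μ) * γ) * ε ^ 2 < R ^ 2) :
    ε ≤ R ∧ (μ - 1) * γ * ε ^ 2 ≤ (R - ε) ^ 2 := by
  obtain ⟨y, hy, hyy⟩ : ∃ y, 0 ≤ y ∧ y ^ 2 = (μ - 1) * γ :=
    ⟨_, Real.sqrt_nonneg _, Real.sq_sqrt (mul_nonneg (by linarith) hγ)⟩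
  have hfactor : (1 + y) ^ 2 ≤ 1 + μ + (μ - 1 / μ) * γ := by
    have hsplit : (μ - 1 / μ) * γ = (1 + 1 / μ) * y ^ 2 := by rw [hyy]; field_simp; ring
    have hsq : 1 + μ + (μ - 1 / μ) * γ = (1 + y) ^ 2 + (y - μ) ^ 2 / μ := by
      rw [hsplit]; field_simp; ring
    rw [hsq]
    exact le_add_of_nonneg_right (by positivity)
  have hle : (1 + y) * ε ≤ R := by
    refine (pow_le_pow_iff_left₀ (by positivity) hR two_ne_zero).1 ?_
    rw [mul_pow]
    exact (mul_le_mul_of_nonneg_right hfactor (sq_nonneg ε)).trans h.le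
  have hyε : 0 ≤ y * ε := mul_nonneg hy hε
  refine ⟨by linarith, ?_⟩
  rw [← hyy, ← mul_pow]
  exact pow_le_pow_left₀ hyε (by linarith) 2

theorem slack_pos (hμ : 0 < μ) (h : (1 + μ + (μ - 1 / μ) * γ) * ε ^ 2 < R ^ 2) :
    0 < μ * R ^ 2 / (μ + 1) - μ * ε ^ 2 - (μ - 1) * γ * ε ^ 2 := by
  have hfactor : μ * R ^ 2 / (μ + 1) - μ * ε ^ 2 - (μ - 1) * γ * ε ^ 2 =
      μ / (μ + 1) * (R ^ 2 - (1 + μ + (μ - 1 / μ) * γ) * ε ^ 2) := by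
    field_simp
    ring
  rw [hfactor]
  exact mul_pos (by positivity) (sub_pos.2 h)

theorem slack_lt (hμ : 1 ≤ μ) (hγ : 0 ≤ γ) (hε : 0 < ε) (hR : 0 ≤ R) :
    μ * R ^ 2 / (μ + 1) - μ * ε ^ 2 - (μ - 1) * γ * ε ^ 2 < (R + ε) ^ 2 := by
  have hdiv : μ * R ^ 2 / (μ + 1) ≤ R ^ 2 := by
    rw [div_le_iff₀ (by linarith)]
    linarith [sq_nonneg R]
  have hgap : 0 ≤ (μ - 1) * γ * ε ^ 2 :=
    mul_nonneg (mul_nonneg (sub_nonneg.2 hμ) hγ) (sq_nonneg ε)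
  have hμε : 0 < μ * ε ^ 2 := by positivity
  have hsq : R ^ 2 ≤ (R + ε) ^ 2 := pow_le_pow_left₀ hR (by linarith) 2
  linarith

-- With `η` the slack divided by `(R + ε) ^ 2`, the slack dominates `η * (R + x) ^ 2` for all `x`
-- in question, so that the fraction `1 - η` of the new power suffices.
theorem exists_perturbation (hμ : 1 ≤ μ) (hγ : 0 ≤ γ) (hε : 0 < ε) (hR : 0 < R)
    (h : (1 + μ + (μ - 1 / μ) * γ) * ε ^ 2 < R ^ 2) :
    ∃ τ k : ℝ, 0 < τ ∧ μ * τ < 1 ∧ ∀ x, |x| ≤ ε →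
      ε ^ 2 + 2 * k * x + k ^ 2 + γ * ((μ - 1) * ε ^ 2 * τ) ≤ τ * (R + x) ^ 2 := by
  have hμ0 : 0 < μ := by linarith
  obtain ⟨hεR, -⟩ := le_and_mul_sq_le_sub_sq hμ hγ hε.le hR.le h
  have hpos := slack_pos hμ0 h
  have hlt := slack_lt hμ hγ hε hR.le
  set g := μ * R ^ 2 / (μ + 1) - μ * ε ^ 2 - (μ - 1) * γ * ε ^ 2 with hg
  set η := g / (R + ε) ^ 2 with hη
  set k := R / (μ + 1) with hk
  have hη0 : 0 < η := by positivity
  have hη1 : η < 1 := (div_lt_one (by positivity)).2 hlt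
  refine ⟨(1 - η) / μ, k, div_pos (by linarith) hμ0, ?_, fun x hx => ?_⟩
  · rw [mul_div_cancel₀ _ hμ0.ne']
    linarith
  obtain ⟨hx1, hx2⟩ := abs_le.1 hx
  have hsquare : (R + x) ^ 2 - μ * (ε ^ 2 + 2 * k * x + k ^ 2) =
      (R + x - μ * k) ^ 2 + (g + (μ - 1) * γ * ε ^ 2) := by
    rw [hg, hk]
    field_simp
    ring
  have hηx : η * (R + x) ^ 2 ≤ g := by
    rw [hη, div_mul_eq_mul_div, div_le_iff₀ (by positivity)]
    exact mul_le_mul_of_nonneg_left (pow_le_pow_left₀ (by linarith) (by linarith) 2) hpos.le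
  have hηγ : 0 ≤ η * ((μ - 1) * γ * ε ^ 2) :=
    mul_nonneg hη0.le (mul_nonneg (mul_nonneg (sub_nonneg.2 hμ) hγ) (sq_nonneg ε))
  have hμle : μ * (ε ^ 2 + 2 * k * x + k ^ 2) ≤
      (1 - η) * ((R + x) ^ 2 - (μ - 1) * γ * ε ^ 2) := by
    linarith [sq_nonneg (R + x - μ * k)]
  calc ε ^ 2 + 2 * k * x + k ^ 2 + γ * ((μ - 1) * ε ^ 2 * ((1 - η) / μ))
      ≤ (1 - η) * ((R + x) ^ 2 - (μ - 1) * γ * ε ^ 2) / μ +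
          γ * ((μ - 1) * ε ^ 2 * ((1 - η) / μ)) := by
        gcongr
        rwa [le_div_iff₀' hμ0]
    _ = (1 - η) / μ * (R + x) ^ 2 := by ring

end Perturbation

theorem sum_norm_sq_add_smul (e v : Fin N → ℂ) (k : ℝ) :
    ∑ i, ‖(e + k • v) i‖ ^ 2 =
      ∑ i, ‖e i‖ ^ 2 + 2 * k * (star v ⬝ᵥ e).re + k ^ 2 * ∑ i, ‖v i‖ ^ 2 := by
  rw [dotProduct, Complex.re_sum, Finset.mul_sum, Finset.mul_sum, ← Finset.sum_add_distrib,
    ← Finset.sum_add_distrib]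
  refine Finset.sum_congr rfl fun i _ => ?_
  simp only [Complex.sq_norm, Complex.normSq_apply, Pi.add_apply, Pi.smul_apply, Pi.star_apply,
    RCLike.star_def, Complex.add_re, Complex.add_im, Complex.smul_re, Complex.smul_im,
    smul_eq_mul, Complex.mul_re, Complex.conj_re, Complex.conj_im]
  ring

/-- The lifted solution `S` with `D` subtracted from the matrix of user `m` and power `t` added
in each direction `v j`; it is cheaper than `S` if `t` is small compared to the trace of `D`. -/
noncomputable def shift (S : Lifted N M) (m : Fin M) (D : Matrix (Fin N) (Fin N) ℂ) (t : ℝ)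
    (v : Fin M → Fin N → ℂ) : Lifted N M :=
  fun j => S j - (Pi.single m D : Lifted N M) j +
    t • Matrix.vecMulVec (v j) (star (v j))

section Shift

variable {S : Lifted N M} {D : Matrix (Fin N) (Fin N) ℂ} {t : ℝ} {v : Fin M → Fin N → ℂ}
  {a : Fin N → ℂ}

theorem liftedPower_shift (hv : ∀ j, ∑ i, ‖v j i‖ ^ 2 = 1) :
    liftedPower (shift S m D t v) = liftedPower S - D.trace.re + M * t := by
  have hsingle : ∑ j, ((Pi.single m D : Lifted N M) j).trace.re =
      D.trace.re := by
    rw [Fintype.sum_eq_single m fun j hj => by simp [Pi.single_eq_of_ne hj], Pi.single_eq_same]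
  simp only [liftedPower, shift, Matrix.trace_add, Matrix.trace_sub, Matrix.trace_smul,
    Complex.add_re, Complex.sub_re, Complex.smul_re, re_trace_vecMulVec, hv,
    Finset.sum_add_distrib, Finset.sum_sub_distrib, hsingle]
  simp

theorem posSemidef_shift (hS : ∀ j, (S j).PosSemidef)
    (hSm : S m = Matrix.vecMulVec a (star a) + D) (ht : 0 ≤ t) (j : Fin M) :
    (shift S m D t v j).PosSemidef := by
  refine .add ?_ ((Matrix.posSemidef_vecMulVec_self_star (v j)).smul ht)
  obtain rfl | hj := eq_or_ne j m
  · rw [Pi.single_eq_same, hSm, add_sub_cancel_right]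
    exact Matrix.posSemidef_vecMulVec_self_star a
  · rw [Pi.single_eq_of_ne hj, sub_zero]
    exact hS j

theorem apply_eq_zero_of_row_eq_zero {A : Matrix (Fin N) (Fin N) ℂ} (hD : D.PosSemidef)
    (hA : A = Matrix.vecMulVec a (star a) + D) {n : Fin N} (hn : A.row n = 0) : a n = 0 := by
  have hdiag : ‖a n‖ ^ 2 + (D n n).re = 0 := by
    have hnn : A n n = 0 := congrFun hn n
    rw [hA, Matrix.add_apply, Matrix.vecMulVec_apply, Pi.star_apply, RCLike.star_def,
      Complex.mul_conj'] at hnn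
    exact_mod_cast congrArg Complex.re hnn
  have hDn : 0 ≤ (D n n).re := re_diag_nonneg hD n
  rw [← norm_eq_zero, ← sq_eq_zero_iff]
  linarith [sq_nonneg ‖a n‖]

theorem row_shift_eq_zero (hD : D.PosSemidef) (hSm : S m = Matrix.vecMulVec a (star a) + D)
    {j : Fin M} {n : Fin N} (hn : (S j).row n = 0) (hv : v j n = 0) :
    (shift S m D t v j).row n = 0 := by
  have hsub : (S j - (Pi.single m D : Lifted N M) j).row n = 0 := by
    obtain rfl | hj := eq_or_ne j m
    · rw [Pi.single_eq_same, hSm, add_sub_cancel_right]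
      ext i
      simp [Matrix.vecMulVec_apply, apply_eq_zero_of_row_eq_zero hD hSm hn]
    · rwa [Pi.single_eq_of_ne hj, sub_zero]
  ext i
  have hi := congrFun hsub i
  simp_all [shift, Matrix.vecMulVec_apply]

theorem quad_shift (j : Fin M) (h : Fin N → ℂ) :
    quad (shift S m D t v j) h = quad (S j) h -
      quad ((Pi.single m D : Lifted N M) j) h +
        t * ‖star (v j) ⬝ᵥ h‖ ^ 2 := by
  rw [shift, quad_add, quad_smul, quad_vecMulVec, quad, Matrix.sub_mulVec, dotProduct_sub,
    Complex.sub_re, quad, quad]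

end Shift

section Tightness

variable {S : Lifted N M} {D : Matrix (Fin N) (Fin N) ℂ} {t : ℝ} {v : Fin M → Fin N → ℂ}
  {R : Fin M → ℝ}

theorem quad_single_nonneg (hD : D.PosSemidef) (j : Fin M) (h : Fin N → ℂ) :
    0 ≤ quad ((Pi.single m D : Lifted N M) j) h := by
  refine quad_nonneg ?_ h
  obtain rfl | hj := eq_or_ne j m
  · rwa [Pi.single_eq_same]
  · rw [Pi.single_eq_of_ne hj]
    exact .zero

theorem sum_quad_shift_le (hv : ∀ l, IsZeroForcing P T l (v l) (R l)) (hD : D.PosSemidef)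
    (ht : 0 ≤ t) {j : Fin M} {h : Fin N → ℂ} (hh : h ∈ channelBall P j) :
    ∑ l ∈ Finset.univ.erase j, quad (shift S m D t v l) h ≤
      ∑ l ∈ Finset.univ.erase j, quad (S l) h + t * ((M - 1) * P.ε j ^ 2) := by
  calc ∑ l ∈ Finset.univ.erase j, quad (shift S m D t v l) h
      ≤ ∑ l ∈ Finset.univ.erase j, (quad (S l) h + t * ‖star (v l) ⬝ᵥ h‖ ^ 2) := by
        refine Finset.sum_le_sum fun l _ => ?_
        rw [quad_shift]
        gcongr
        exact sub_le_self _ (quad_single_nonneg hD l h)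
    _ = ∑ l ∈ Finset.univ.erase j, quad (S l) h +
          t * ∑ l ∈ Finset.univ.erase j, ‖star (v l) ⬝ᵥ h‖ ^ 2 := by
        rw [Finset.sum_add_distrib, Finset.mul_sum]
    _ ≤ _ := by
        gcongr
        exact IsZeroForcing.sum_norm_dotProduct_sq_le hv hh

theorem sdrConstraint_shift (hσ : ∀ m, 0 < P.σ m) (hγ : ∀ m, 0 < P.γ m)
    (hv : ∀ l, IsZeroForcing P T l (v l) (R l)) (hS : sdrConstraint P S) (hD : D.PosSemidef)
    (ht : 0 ≤ t) (hpsd : ∀ j, (shift S m D t v j).PosSemidef)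
    (hgain : ∀ j, ∀ h ∈ channelBall P j,
      quad ((Pi.single m D : Lifted N M) j) h + P.γ j * (t * ((M - 1) * P.ε j ^ 2)) ≤
        t * ‖star (v j) ⬝ᵥ h‖ ^ 2) :
    sdrConstraint P (shift S m D t v) := by
  rw [sdrConstraint_iff hσ] at hS ⊢
  refine ⟨hpsd, fun j h hh => ?_⟩
  calc P.γ j * (∑ l ∈ Finset.univ.erase j, quad (shift S m D t v l) h + P.σ j ^ 2)
      ≤ P.γ j * (∑ l ∈ Finset.univ.erase j, quad (S l) h + t * ((M - 1) * P.ε j ^ 2) +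
          P.σ j ^ 2) := by
        gcongr
        · exact (hγ j).le
        · exact sum_quad_shift_le hv hD ht hh
    _ ≤ quad (S j) h + P.γ j * (t * ((M - 1) * P.ε j ^ 2)) := by linarith [hS.2 j h hh]
    _ ≤ quad (shift S m D t v j) h := by
        rw [quad_shift]
        linarith [hgain j h hh]

theorem quad_le_of_mulVec_eq_zero {w : Fin N → ℂ} {r k : ℝ} (hD : D.PosSemidef)
    (hw : IsZeroForcing P T m w r) (hDw : D *ᵥ (P.H.col m - k • w) = 0) {h : Fin N → ℂ}
    (hh : h ∈ channelBall P m) :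
    quad D h ≤ D.trace.re *
      (P.ε m ^ 2 + 2 * k * (star w ⬝ᵥ (h - P.H.col m)).re + k ^ 2) := by
  have hsplit : h = (P.H.col m - k • w) + ((h - P.H.col m) + k • w) := by abel
  calc quad D h = quad D ((h - P.H.col m) + k • w) := by
        conv_lhs => rw [hsplit, quad_add_of_mulVec_eq_zero hD.isHermitian hDw]
    _ ≤ D.trace.re * ∑ i, ‖((h - P.H.col m) + k • w) i‖ ^ 2 := quad_le_trace_mul hD _
    _ ≤ _ := by
        rw [sum_norm_sq_add_smul, hw.sum_norm_sq, mul_one]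
        have htrace : 0 ≤ D.trace.re := (Complex.le_def.1 hD.trace_nonneg).1
        gcongr
        exact sum_norm_sq_sub_le_of_mem_channelBall hh

theorem quad_single_add_le {τ k : ℝ} (hγ : ∀ m, 0 < P.γ m) (hε : ∀ m, 0 < P.ε m)
    (hv : ∀ l, IsZeroForcing P T l (v l) (R l))
    (hR : ∀ l, (1 + M + (M - 1 / M) * P.γ l) * P.ε l ^ 2 < R l ^ 2) (hD : D.PosSemidef)
    (hDv : D *ᵥ (P.H.col m - k • v m) = 0) (hτ : 0 ≤ τ)
    (hpert : ∀ x, |x| ≤ P.ε m → P.ε m ^ 2 + 2 * k * x + k ^ 2 +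
      P.γ m * ((M - 1) * P.ε m ^ 2 * τ) ≤ τ * (R m + x) ^ 2)
    (j : Fin M) {h : Fin N → ℂ} (hh : h ∈ channelBall P j) :
    quad ((Pi.single m D : Lifted N M) j) h +
      P.γ j * (D.trace.re * τ * ((M - 1) * P.ε j ^ 2)) ≤
        D.trace.re * τ * ‖star (v j) ⬝ᵥ h‖ ^ 2 := by
  have htrace : 0 ≤ D.trace.re := (Complex.le_def.1 hD.trace_nonneg).1
  have hx := (hv j).abs_re_dotProduct_sub_le (hε j).le hh
  refine le_trans ?_ (mul_le_mul_of_nonneg_left ((hv j).sq_le_norm_dotProduct_sq h)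
    (mul_nonneg htrace hτ))
  obtain rfl | hj := eq_or_ne j m
  · rw [Pi.single_eq_same]
    have hquad := quad_le_of_mulVec_eq_zero hD (hv j) hDv hh
    have hmul := mul_le_mul_of_nonneg_left (hpert _ hx) htrace
    linarith
  · rw [Pi.single_eq_of_ne hj]
    obtain ⟨hεR, hsq⟩ := le_and_mul_sq_le_sub_sq (by exact_mod_cast j.pos) (hγ j).le (hε j).le
      (hv j).gain_pos.le (hR j)
    have hle := pow_le_pow_left₀ (sub_nonneg.2 hεR)
      (by linarith [(abs_le.1 hx).1] : R j - P.ε j ≤ R j + (star (v j) ⬝ᵥ (h - P.H.col j)).re) 2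
    have hmul := mul_le_mul_of_nonneg_left (hsq.trans hle) (mul_nonneg htrace hτ)
    have hzero : quad (0 : Matrix (Fin N) (Fin N) ℂ) h = 0 := by simp [quad]
    linarith

theorem exists_eq_vecMulVec_of_optimal (hLN : L ≤ N) (hσ : ∀ m, 0 < P.σ m)
    (hγ : ∀ m, 0 < P.γ m) (hε : ∀ m, 0 < P.ε m) (hcond : sdrCondition P L)
    (hT : T.card = N - L) (hS : S ∈ (sdr P T).feasible)
    (hopt : ∀ S' ∈ (sdr P T).feasible, liftedPower S ≤ liftedPower S') (m : Fin M) :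
    ∃ a : Fin N → ℂ, S m = Matrix.vecMulVec a (star a) := by
  have hTc : L ≤ Tᶜ.card := by rw [Finset.card_compl, Fintype.card_fin]; omega
  choose v R hv hR using exists_isZeroForcing hε hγ hcond hTc
  obtain ⟨τ, k, hτ, hMτ, hpert⟩ := exists_perturbation (by exact_mod_cast m.pos) (hγ m).le
    (hε m) (hv m).gain_pos (hR m)
  obtain ⟨a, D, hD, hDv, hSm⟩ := exists_eq_vecMulVec_add (hS.1.1 m) (P.H.col m - k • v m)
  obtain ⟨hd, him⟩ : 0 ≤ D.trace.re ∧ 0 = D.trace.im := Complex.le_def.1 hD.trace_nonneg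
  have ht : 0 ≤ D.trace.re * τ := mul_nonneg hd hτ.le
  have hpsd := posSemidef_shift (v := v) hS.1.1 hSm ht
  have hfeas : shift S m D (D.trace.re * τ) v ∈ (sdr P T).feasible :=
    ⟨sdrConstraint_shift hσ hγ hv hS.1 hD ht hpsd fun j h hh =>
        quad_single_add_le hγ hε hv hR hD hDv hτ.le hpert j hh,
      fun j n hn => row_shift_eq_zero hD hSm (hS.2 j n hn) ((hv j).apply_eq_zero n hn)⟩
  have hpower := hopt _ hfeas
  rw [liftedPower_shift fun j => (hv j).sum_norm_sq] at hpower
  have hd0 : D.trace.re = 0 := by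
    refine le_antisymm ?_ hd
    by_contra! hpos
    have hlt := mul_lt_mul_of_pos_left hMτ hpos
    linarith
  have hD0 : D = 0 := hD.trace_eq_zero_iff.1 (Complex.ext hd0 him.symm)
  exact ⟨a, by rw [hSm, hD0, add_zero]⟩

end Tightness

/-! ### Imperfect CSI -/

/-- The lifted solution that corresponds to a beamforming matrix. -/
def rankOneLift (W : Beam N M) : Lifted N M :=
  fun m => Matrix.vecMulVec (W.col m) (star (W.col m))

theorem liftedPower_rankOneLift (W : Beam N M) : liftedPower (rankOneLift W) = power W := by
  simp only [liftedPower, rankOneLift, re_trace_vecMulVec, power]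
  exact Finset.sum_comm

theorem row_rankOneLift_eq_zero_iff {W : Beam N M} {n : Fin N} :
    (∀ m, (rankOneLift W m).row n = 0) ↔ W.row n = 0 := by
  constructor
  · intro h
    ext m
    have hnn : W n m * star (W n m) = 0 := congrFun (h m) n
    exact (mul_eq_zero.1 hnn).elim id star_eq_zero.1
  · intro h m
    ext i
    have hnm : W n m = 0 := congrFun h m
    simp [rankOneLift, Matrix.vecMulVec_apply, hnm]

theorem rankOneLift_mem_feasible_iff {W : Beam N M} :
    rankOneLift W ∈ (sdr P T).feasible ↔
      (∀ m, ∀ h ∈ channelBall P m, P.γ m ≤ sinr P W m h) ∧ ∀ n ∈ T, W.row n = 0 := by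
  have hpsd (m : Fin M) : (rankOneLift W m).PosSemidef := Matrix.posSemidef_vecMulVec_self_star _
  have hquad (m : Fin M) (h : Fin N → ℂ) : quad (rankOneLift W m) h = ‖gain W m h‖ ^ 2 :=
    quad_vecMulVec _ _
  have hrows : (∀ m, ∀ n ∈ T, (rankOneLift W m).row n = 0) ↔ ∀ n ∈ T, W.row n = 0 :=
    ⟨fun h n hn => row_rankOneLift_eq_zero_iff.1 fun m => h m n hn,
      fun h m n hn => row_rankOneLift_eq_zero_iff.2 (h n hn) m⟩
  simp only [sdr, Set.mem_ofPred_eq, sdrConstraint, hpsd, implies_true, true_and, hquad, hrows,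
    sinr]

theorem exists_extract_eq_some {S : Lifted N M}
    (h : ∀ m, ∃ a : Fin N → ℂ, S m = Matrix.vecMulVec a (star a)) :
    ∃ W, extract S = some W ∧ S = rankOneLift W := by
  choose a ha using h
  have hW : ∃ W : Beam N M, ∀ m, S m = Matrix.vecMulVec (W.col m) (star (W.col m)) :=
    ⟨Matrix.of fun n m => a m n, ha⟩
  exact ⟨hW.choose, dif_pos hW, funext hW.choose_spec⟩

theorem isExact_sdrBB (hLN : L ≤ N) (hσ : ∀ m, 0 < P.σ m) (hγ : ∀ m, 0 < P.γ m)
    (hε : ∀ m, 0 < P.ε m) (hcond : sdrCondition P L)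
    {solve : Finset (Fin N) → Option (Lifted N M)} (h : IsSolver (sdr P) solve) :
    (sdrBB solve).IsExact L (rbfas P L) where
  ubKey_eq _ _ _ := rfl
  exists_beam T hT S hS := by
    obtain ⟨hfeas, hopt⟩ := (h T).1 S hS
    obtain ⟨W, hext, rfl⟩ := exists_extract_eq_some
      (exists_eq_vecMulVec_of_optimal hLN hσ hγ hε hcond hT hfeas hopt)
    obtain ⟨hsinr, hrows⟩ := rankOneLift_mem_feasible_iff.1 hfeas
    exact ⟨W, ⟨hsinr, (rowZero_le_iff hLN).2 ⟨T, hT, hrows⟩⟩, hext,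
      (liftedPower_rankOneLift W).symm⟩
  relax W hW := by
    obtain ⟨T, hT, hrows⟩ := (rowZero_le_iff hLN).1 hW.2
    refine ⟨T, hT, fun ν hν => liftedPower_rankOneLift W ▸
      Method.lb_le_of_mem_feasible (E := sdrBB solve) h rfl ?_⟩
    exact rankOneLift_mem_feasible_iff.2 ⟨hW.1, fun n hn => hrows n (hν.1 hn)⟩

end BFAS

theorem theorem1 (N M L : ℕ) (hM : 0 < M) (hL : 1 ≤ L) (hLN : L ≤ N)
    (P : BFAS.Instance N M) (hσ : ∀ m, 0 < P.σ m) (hγ : ∀ m, 0 < P.γ m) :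
    -- (a) perfect CSI
    ((∃ solve, BFAS.IsSolver (BFAS.socp P) solve) ∧
      ∀ solve, BFAS.IsSolver (BFAS.socp P) solve → ∀ tol : ℝ≥0,
        (BFAS.socpBB solve).SolvesOptimally L tol (BFAS.bfas P L)) ∧
    -- (b) imperfect CSI
    ((∀ m, 0 < P.ε m) → BFAS.sdrCondition P L →
      (∃ solve, BFAS.IsSolver (BFAS.sdr P) solve) ∧
      ∀ solve, BFAS.IsSolver (BFAS.sdr P) solve → ∀ tol : ℝ≥0,
        (BFAS.sdrBB solve).SolvesOptimally L tol (BFAS.rbfas P L)) ∧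
    -- (c) number of SOCPs/SDRs solved by the proposed method
    (∀ tol : ℝ≥0,
      (∀ solve, BFAS.IsSolver (BFAS.socp P) solve →
        (BFAS.socpBB solve).SolvesAtMost L tol
          (N.choose L + ∑ i ∈ Finset.Icc 2 (N - L + 1), (N - i).choose (L - 1))) ∧
      (∀ solve, BFAS.IsSolver (BFAS.sdr P) solve →
        (BFAS.sdrBB solve).SolvesAtMost L tol
          (N.choose L + ∑ i ∈ Finset.Icc 2 (N - L + 1), (N - i).choose (L - 1)))) ∧
    -- (c) number of SOCPs/SDRs solved by the alternative method
    (∀ C : ℝ, 0 < C →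
      (∃ solve, BFAS.IsSolver (BFAS.bigMSocp P L C) solve) ∧
      (∃ solve, BFAS.IsSolver (BFAS.bigMSdr P L C) solve) ∧
      ∀ tol : ℝ≥0,
        (∀ solve, BFAS.IsSolver (BFAS.bigMSocp P L C) solve →
          (BFAS.bigMSocpBB solve).SolvesAtMost L tol (2 * N.choose L - 1)) ∧
        (∀ solve, BFAS.IsSolver (BFAS.bigMSdr P L C) solve →
          (BFAS.bigMSdrBB solve).SolvesAtMost L tol (2 * N.choose L - 1))) := by
  refine ⟨⟨BFAS.exists_isSolver_socp P, fun solve h =>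
      (BFAS.isExact_socpBB hLN hσ hγ h).solvesOptimally (BFAS.Method.canSelect_socpBB solve) hLN⟩,
    fun hε hcond => ⟨BFAS.exists_isSolver_sdr hσ, fun solve h =>
      (BFAS.isExact_sdrBB hLN hσ hγ hε hcond h).solvesOptimally
        (BFAS.Method.canSelect_sdrBB solve) hLN⟩,
    fun tol => ⟨fun solve _ => BFAS.Method.solvesAtMost_of_lbKey_eq_B
        (BFAS.Method.canSelect_socpBB solve) rfl rfl hL hLN tol,
      fun solve _ => BFAS.Method.solvesAtMost_of_lbKey_eq_B
        (BFAS.Method.canSelect_sdrBB solve) rfl rfl hL hLN tol⟩,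
    fun C _ => ⟨BFAS.exists_isSolver_bigMSocp P C, BFAS.exists_isSolver_bigMSdr hσ C,
      fun tol => ⟨fun solve _ => BFAS.Method.solvesAtMost_of_lbKey_eq_id
          (BFAS.Method.canSelect_of_forall_may (fun _ _ _ => trivial) fun _ _ _ => trivial)
          rfl rfl hLN tol,
        fun solve _ => BFAS.Method.solvesAtMost_of_lbKey_eq_id
          (BFAS.Method.canSelect_of_forall_may (fun _ _ _ => trivial) fun _ _ _ => trivial)
          rfl rfl hLN tol⟩⟩⟩
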